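/- Write $\mathcal O=\mathcal O_{\mathbb C^{2n},0}=\mathbb C\{p_1,\dots,p_n,q_1,\dots,q_n\}$ for the ring of germs at $0$ of holomorphic functions on $\mathbb C^{2n}$, with symplectic form $\omega=\sum_i dp_i\wedge dq_i$ and Poisson bracket $\{f,g\}=\sum_i\bigl(\tfrac{\partial f}{\partial p_i}\tfrac{\partial g}{\partial q_i}-\tfrac{\partial f}{\partial q_i}\tfrac{\partial g}{\partial p_i}\bigr)$. Let $(L,0)\subset(\mathbb C^{2n},0)$ be a lagrangian complete intersection germ with ideal $I\subset\mathcal O$ and local ring $\mathcal O_{L,0}=\mathcal O/I$; that is, $(L,0)$ is a reduced germ of pure dimension $n$, $\omega$ vanishes on the regular part of $L$, and $I$ is generated by $2n-\dim L=n$ elements. Let $\mathrm{Sing}(L)$ be the singular locus of $L$ (its codimension in $L$ is $\infty$ if it is empty), and assume $\operatorname{codim}_L(\mathrm{Sing}(L))\ge 2$. Then: 1. the tangent module $\Theta_{L,0}=\mathrm{Der}_{\mathbb C}(\mathcal O_{L,0},\mathcal O_{L,0})$ is a free $\mathcal O_{L,0}$-module; 2. $\Theta_{L,0}$ is isomorphic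 to the conormal module: the assignment $f\mapsto\{f,\cdot\}$ induces a well-defined isomorphism of $\mathcal O_{L,0}$-modules $I/I^2\to\Theta_{L,0}$; 3. if $(L,0)$ is quasi-homogeneous, i.e. if there are a derivation $E\in\Theta_{L,0}$ and finitely many generators $x_i$ of the maximal ideal of $\mathcal O_{L,0}$ with $E(x_i)=w_ix_i$ for integers $w_i>0$, then $(L,0)$ is smooth, i.e. $\mathcal O_{L,0}$ is a regular local ring; 4. if $\operatorname{codim}_L(\mathrm{Sing}(L))\ge 3$, then $(L,0)$ is smooth. -/

import Mathlib

/-! ## Convergent power series: the local ring of germs of holomorphic functions -/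

/-- The power series `f` converges absolutely on some polydisc of positive radius around `0`. -/
def MvPowerSeries.IsConvergent {σ : Type*} (f : MvPowerSeries σ ℂ) : Prop :=
  ∃ r : ℝ, 0 < r ∧ Summable fun d : σ →₀ ℕ => ‖MvPowerSeries.coeff d f‖ * r ^ d.degree

theorem MvPowerSeries.summable_of_le {σ : Type*} {f : MvPowerSeries σ ℂ} {r s : ℝ}
    (hs : 0 ≤ s) (hsr : s ≤ r)
    (h : Summable fun d : σ →₀ ℕ => ‖MvPowerSeries.coeff d f‖ * r ^ d.degree) :
    Summable fun d : σ →₀ ℕ => ‖MvPowerSeries.coeff d f‖ * s ^ d.degree :=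
  Summable.of_nonneg_of_le (fun _ => by positivity) (fun _ => by gcongr) h

theorem MvPowerSeries.summable_of_eq_zero {σ : Type*} {f : MvPowerSeries σ ℂ} (r : ℝ)
    (d₀ : σ →₀ ℕ) (h : ∀ d, d ≠ d₀ → MvPowerSeries.coeff d f = 0) :
    Summable fun d : σ →₀ ℕ => ‖MvPowerSeries.coeff d f‖ * r ^ d.degree :=
  summable_of_ne_finset_zero (s := {d₀}) fun d hd => by
    simp [h d (by simpa using hd)]

theorem MvPowerSeries.IsConvergent.add {σ : Type*} {f g : MvPowerSeries σ ℂ}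
    (hf : f.IsConvergent) (hg : g.IsConvergent) : (f + g).IsConvergent := by
  obtain ⟨r, hr, hf⟩ := hf
  obtain ⟨s, hs, hg⟩ := hg
  have h0 : 0 < min r s := lt_min hr hs
  refine ⟨min r s, h0, Summable.of_nonneg_of_le (fun _ => by positivity) (fun d => ?_)
    ((summable_of_le h0.le (min_le_left _ _) hf).add
      (summable_of_le h0.le (min_le_right _ _) hg))⟩
  rw [map_add, ← add_mul]
  gcongr
  exact norm_add_le _ _

theorem MvPowerSeries.IsConvergent.mul {σ : Type*} {f g : MvPowerSeries σ ℂ}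
    (hf : f.IsConvergent) (hg : g.IsConvergent) : (f * g).IsConvergent := by
  classical
  obtain ⟨r, hr, hf⟩ := hf
  obtain ⟨s, hs, hg⟩ := hg
  have h0 : 0 < min r s := lt_min hr hs
  have hf' := summable_of_le h0.le (min_le_left r s) hf
  have hg' := summable_of_le h0.le (min_le_right r s) hg
  have hp := Summable.mul_of_nonneg hf' hg' (fun d => by positivity) (fun d => by positivity)
  have hfg : Summable fun d : σ →₀ ℕ => ∑ x ∈ Finset.HasAntidiagonal.antidiagonal d,
      (‖coeff x.1 f‖ * min r s ^ x.1.degree) * (‖coeff x.2 g‖ * min r s ^ x.2.degree) :=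
    summable_sum_mul_antidiagonal_of_summable_mul
      (f := fun d : σ →₀ ℕ => ‖coeff d f‖ * min r s ^ d.degree)
      (g := fun d : σ →₀ ℕ => ‖coeff d g‖ * min r s ^ d.degree) hp
  refine ⟨min r s, h0, Summable.of_nonneg_of_le (fun _ => by positivity) (fun d => ?_) hfg⟩
  have h1 : ‖coeff d (f * g)‖ ≤ ∑ x ∈ Finset.HasAntidiagonal.antidiagonal d,
      ‖coeff x.1 f‖ * ‖coeff x.2 g‖ := by
    rw [coeff_mul]
    exact norm_sum_le_of_le _ fun x _ => norm_mul_le _ _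
  refine (mul_le_mul_of_nonneg_right h1 (by positivity)).trans (le_of_eq ?_)
  rw [Finset.sum_mul]
  refine Finset.sum_congr rfl fun x hx => ?_
  have h2 : d.degree = x.1.degree + x.2.degree := by
    rw [← Finset.HasAntidiagonal.mem_antidiagonal.mp hx, map_add]
  rw [h2, pow_add]
  ring

theorem MvPowerSeries.IsConvergent.pderiv {σ : Type*} {f : MvPowerSeries σ ℂ}
    (hf : f.IsConvergent) (i : σ) : (MvPowerSeries.pderiv ℂ i f).IsConvergent := by
  obtain ⟨r, hr, hf⟩ := hf
  have hinj : Function.Injective fun d : σ →₀ ℕ => d + Finsupp.single i 1 :=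
    add_left_injective _
  refine ⟨r / 2, half_pos hr, Summable.of_nonneg_of_le (fun _ => by positivity) (fun d => ?_)
    ((hf.comp_injective hinj).mul_left r⁻¹)⟩
  have h1 : ‖((d i : ℂ) + 1)‖ ≤ 2 ^ d.degree := by
    have h2 : d i + 1 ≤ 2 ^ d.degree :=
      (Nat.succ_le_succ (Finsupp.le_degree i d)).trans Nat.lt_two_pow_self
    calc ‖((d i : ℂ) + 1)‖ = ((d i + 1 : ℕ) : ℝ) := by
          rw [← Nat.cast_one, ← Nat.cast_add, Complex.norm_natCast]
      _ ≤ 2 ^ d.degree := by exact_mod_cast h2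
  simp only [Function.comp_apply, coeff_pderiv, map_add, Finsupp.degree_single, norm_mul]
  calc ‖coeff (d + Finsupp.single i 1) f‖ * ‖((d i : ℂ) + 1)‖ * (r / 2) ^ d.degree
      ≤ ‖coeff (d + Finsupp.single i 1) f‖ * 2 ^ d.degree * (r / 2) ^ d.degree := by gcongr
    _ = r⁻¹ * (‖coeff (d + Finsupp.single i 1) f‖ * r ^ (d.degree + 1)) := by
      rw [div_pow, pow_succ]
      field_simp

/-- The convergent power series form a subalgebra of the formal power series. -/
noncomputable def convergentSubalgebra (σ : Type*) : Subalgebra ℂ (MvPowerSeries σ ℂ) where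
  carrier := {f | f.IsConvergent}
  mul_mem' := MvPowerSeries.IsConvergent.mul
  add_mem' := MvPowerSeries.IsConvergent.add
  algebraMap_mem' c := ⟨1, one_pos, MvPowerSeries.summable_of_eq_zero 1 0 fun _ hd =>
    MvPowerSeries.coeff_C_of_ne_zero hd c⟩

/-- The ring `ℂ{x_i : i ∈ σ}` of convergent power series, i.e. of germs at `0` of holomorphic
functions on `ℂ^σ` (`σ` finite). -/
def ConvergentSeries (σ : Type*) : Type _ := convergentSubalgebra σ

namespace ConvergentSeries

noncomputable instance (σ : Type*) : CommRing (ConvergentSeries σ) :=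
  inferInstanceAs (CommRing (convergentSubalgebra σ))

noncomputable instance (σ : Type*) : Algebra ℂ (ConvergentSeries σ) :=
  inferInstanceAs (Algebra ℂ (convergentSubalgebra σ))

/-- The inclusion of the convergent power series into the formal power series. -/
noncomputable def toMvPowerSeries (σ : Type*) : ConvergentSeries σ →ₐ[ℂ] MvPowerSeries σ ℂ :=
  (convergentSubalgebra σ).val

/-- The coordinate function `x_i`. -/
noncomputable def coord {σ : Type*} (i : σ) : ConvergentSeries σ :=
  ⟨MvPowerSeries.X i, 1, one_pos,
    MvPowerSeries.summable_of_eq_zero 1 (Finsupp.single i 1) fun d hd => by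
      classical rw [MvPowerSeries.coeff_X, if_neg hd]⟩

/-- The partial derivative `∂/∂x_i` on convergent power series. -/
noncomputable def pderiv {σ : Type*} (i : σ) :
    Derivation ℂ (ConvergentSeries σ) (ConvergentSeries σ) :=
  Derivation.mk'
    { toFun := fun f => ⟨MvPowerSeries.pderiv ℂ i f.1, MvPowerSeries.IsConvergent.pderiv f.2 i⟩
      map_add' := fun f g => Subtype.ext (map_add _ f.1 g.1)
      map_smul' := fun c f => Subtype.ext ((MvPowerSeries.pderiv ℂ i).map_smul c f.1) }
    (fun f g => Subtype.ext ((MvPowerSeries.pderiv ℂ i).leibniz f.1 g.1))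

end ConvergentSeries

/-! ## Germs in the symplectic space `ℂ^{2n}` -/

/-- The local ring `𝒪_{ℂ^{2n},0}`. The coordinates are `p_i = coord (Sum.inl i)` and
`q_i = coord (Sum.inr i)`, and `ℂ^{2n}` carries the symplectic form `ω = ∑ dp_i ∧ dq_i`. -/
abbrev SymplecticGerms (n : ℕ) : Type := ConvergentSeries (Fin n ⊕ Fin n)

/-- The Poisson bracket
`{f, g} = ∑ i, (∂f/∂p_i) (∂g/∂q_i) - (∂f/∂q_i) (∂g/∂p_i)`. -/
noncomputable def poissonBracket {n : ℕ} (f g : SymplecticGerms n) : SymplecticGerms n :=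
  ∑ i : Fin n,
    (ConvergentSeries.pderiv (Sum.inl i) f * ConvergentSeries.pderiv (Sum.inr i) g -
      ConvergentSeries.pderiv (Sum.inr i) f * ConvergentSeries.pderiv (Sum.inl i) g)

/-- The tangent module `Θ_{L,0} = Der_ℂ(𝒪_{L,0}, 𝒪_{L,0})` of the germ `(L,0)` defined by the
ideal `I`, where `𝒪_{L,0} = 𝒪_{ℂ^{2n},0} ⧸ I`. -/
abbrev TangentModule {n : ℕ} (I : Ideal (SymplecticGerms n)) : Type :=
  Derivation ℂ (SymplecticGerms n ⧸ I) (SymplecticGerms n ⧸ I)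

/-- The value `ω(D, D') ∈ 𝒪_{L,0}` of the symplectic form `ω = ∑ dp_i ∧ dq_i` on two vector
fields on `(L,0)`. -/
noncomputable def symplecticPairing {n : ℕ} (I : Ideal (SymplecticGerms n))
    (D D' : TangentModule I) : SymplecticGerms n ⧸ I :=
  ∑ i : Fin n,
    (D (Ideal.Quotient.mk I (ConvergentSeries.coord (Sum.inl i))) *
        D' (Ideal.Quotient.mk I (ConvergentSeries.coord (Sum.inr i))) -
      D (Ideal.Quotient.mk I (ConvergentSeries.coord (Sum.inr i))) *
        D' (Ideal.Quotient.mk I (ConvergentSeries.coord (Sum.inl i))))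

/-- `I` is the ideal of a lagrangian germ `(L,0) ⊂ (ℂ^{2n},0)`: a reduced germ through `0`, all
of whose irreducible components have dimension `n`, and on which `ω` vanishes.

Since `L` is reduced, and the vector fields on `L` span the tangent space of `L` at each of its
regular points, the last condition says that `ω` restricts to `0` on the regular part of `L`. -/
structure IsLagrangianGerm {n : ℕ} (I : Ideal (SymplecticGerms n)) : Prop where
  ne_top : I ≠ ⊤
  isRadical : I.IsRadical
  dim_eq : ∀ P ∈ I.minimalPrimes, ringKrullDim (SymplecticGerms n ⧸ P) = n
  isotropic : ∀ D D' : TangentModule I, symplecticPairing I D D' = 0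

/-- The germ in `(ℂ^{2n},0)` defined by `I` is a complete intersection: `I` is generated by
`2n - dim L` elements. -/
def IsCompleteIntersectionGerm {n : ℕ} (I : Ideal (SymplecticGerms n)) : Prop :=
  ∃ (k : ℕ) (f : Fin k → SymplecticGerms n), Ideal.span (Set.range f) = I ∧
    ringKrullDim (SymplecticGerms n ⧸ I) + k = 2 * n

/-- The ideal in `𝒪_{L,0}` of the singular locus of a germ `(L,0) ⊂ (ℂ^{2n},0)` of pure
dimension `n`: it is generated by the `n × n` minors of the Jacobian matrices of all `n`-tuples
of elements of `I`. Its zeros near `0` are the points of `L` where the differentials of the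
elements of `I` do not have rank `n`, that is, the points where `L` is not smooth. -/
noncomputable def singularLocusIdeal {n : ℕ} (I : Ideal (SymplecticGerms n)) :
    Ideal (SymplecticGerms n ⧸ I) :=
  Ideal.span {x | ∃ (g : Fin n → I) (c : Fin n → Fin n ⊕ Fin n),
    x = Ideal.Quotient.mk I
      (Matrix.det (Matrix.of fun i j => ConvergentSeries.pderiv (c j) (g i).1))}

/-- The codimension in `L` of its singular locus; it is `⊤` if the singular locus is empty. -/
noncomputable def codimSing {n : ℕ} (I : Ideal (SymplecticGerms n)) : ℕ∞ :=
  (singularLocusIdeal I).height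

/-- The germ `(L,0)` is quasi-homogeneous, i.e. its local ring `R` is a positively graded
analytic algebra: there are a vector field `E` and generators `x_i` of the maximal ideal of the
local ring `R` with `E(x_i) = w_i x_i` for positive integers `w_i`. -/
def IsQuasiHomogeneousAlgebra (R : Type*) [CommRing R] [Algebra ℂ R] : Prop :=
  ∃ (E : Derivation ℂ R R) (k : ℕ) (x : Fin k → R) (w : Fin k → ℕ),
    (Ideal.span (Set.range x)).IsMaximal ∧ ∀ i, 0 < w i ∧ E (x i) = w i • x i

/-! ## Perturbation of the identity on weighted `ℓ¹` spaces -/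

/-! Write R for the local ring of L, D for the n × 2n Jacobian matrix over R of n generators of I,
and M = J Dᵀ. Vector fields on L are the vectors in ker D, and the columns of M are the hamiltonian
fields of the generators. Everything rests on the complex 0 → Rⁿ → R²ⁿ → Rⁿ with maps M and D.

The composite D M vanishes: at each generic point D has rank n, so ker D is isotropic of dimension
n, hence equal to the image of M, and R is reduced (`mul_J_mul_transpose_eq_zero`). The ideal of
maximal minors of D contains the ideal of the singular locus, and R is Cohen–Macaulay as a complete
intersection, so codimension at least 2 gives a regular pair of elements in the ideal of minors
(`exists_regular_pair`). Minors kill the homology up to multiplication; with a regular pair M is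
injective and ker D is its image (`mem_range_of_mulVec_eq_zero`). So the tangent module is free. The
same injectivity shows that I/I² is free on the generators, and the two bases match under f ↦ {f,
·}.

In codimension at least 3 a third regular element makes D surjective (`mulVec_surjective`), so the
differentials of the generators are independent at the origin. In the quasi-homogeneous case the
Euler field is hamiltonian, and its linear part is a hamiltonian matrix, whose spectrum is symmetric
under negation. As its eigenvalues on the cotangent space are positive, that space has dimension at
most n (`le_finrank_of_hamiltonian`).

The commutative algebra needs ℂ{x} to be a noetherian local ring in which the coordinates form a
regular sequence. These facts come from a division theorem, proved by perturbing monomial division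
in a weighted ℓ¹ norm. -/

theorem exists_add_map_eq_of_norm_le_half {ι : Type*} (w : ι → ℝ) (hw : ∀ i, 0 < w i)
    (T : (ι → ℂ) →ₗ[ℂ] (ι → ℂ))
    (hT : ∀ G : ι → ℂ, Summable (fun i => ‖G i‖ * w i) →
      Summable (fun i => ‖T G i‖ * w i) ∧
        ∑' i, ‖T G i‖ * w i ≤ 1 / 2 * ∑' i, ‖G i‖ * w i)
    (g : ι → ℂ) (hg : Summable fun i => ‖g i‖ * w i) :
    ∃ G : ι → ℂ, Summable (fun i => ‖G i‖ * w i) ∧ G + T G = g := by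
  have hw' : ∀ i, (w i : ℂ) ≠ 0 := fun i => by exact_mod_cast (hw i).ne'
  have hmem : ∀ G : ι → ℂ, Summable (fun i => ‖G i‖ * w i) ↔
      Memℓp (E := fun _ : ι => ℂ) (fun i => G i * (w i : ℂ)) 1 := by
    intro G
    rw [memℓp_gen_iff (by simp)]
    simp [abs_of_pos (hw _)]
  -- Rescaling coordinate i by w i identifies the weighted space with ℓ¹; `div` is the inverse
  -- rescaling and `L` is T transported to ℓ¹.
  let div : lp (fun _ : ι => ℂ) 1 →ₗ[ℂ] (ι → ℂ) :=
    { toFun := fun x i => x i / (w i : ℂ)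
      map_add' := fun x y => by ext i; simp [add_div]
      map_smul' := fun c x => by ext i; simp [mul_div_assoc] }
  have hdiv : ∀ x i, div x i * (w i : ℂ) = x i := fun x i => div_mul_cancel₀ _ (hw' i)
  have hdivs : ∀ x, Summable (fun i => ‖div x i‖ * w i) := fun x => by
    rw [hmem]; simpa only [hdiv] using lp.memℓp x
  let L : lp (fun _ : ι => ℂ) 1 →ₗ[ℂ] lp (fun _ : ι => ℂ) 1 :=
    { toFun := fun x => ⟨fun i => T (div x) i * (w i : ℂ), (hmem _).1 (hT _ (hdivs x)).1⟩
      map_add' := fun x y => by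
        ext i
        change T (div (x + y)) i * (w i : ℂ) = T (div x) i * (w i : ℂ) + T (div y) i * (w i : ℂ)
        simp [add_mul]
      map_smul' := fun c x => by ext i; simp [mul_assoc] }
  have hnorm : ∀ x : lp (fun _ : ι => ℂ) 1, ‖x‖ = ∑' i, ‖x i‖ := fun x => by
    rw [lp.norm_eq_tsum_rpow (by simp)]; simp
  have hL : ∀ x, ‖L x‖ ≤ 1 / 2 * ‖x‖ := fun x => by
    have h1 : ‖L x‖ = ∑' i, ‖T (div x) i‖ * w i := by
      rw [hnorm]
      refine tsum_congr fun i => ?_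
      change ‖T (div x) i * (w i : ℂ)‖ = _
      simp [abs_of_pos (hw i)]
    have h2 : ‖x‖ = ∑' i, ‖div x i‖ * w i := by
      rw [hnorm]
      refine tsum_congr fun i => ?_
      rw [← hdiv x i]
      simp [abs_of_pos (hw i)]
    rw [h1, h2]
    exact (hT _ (hdivs x)).2
  let L' := L.mkContinuous (1 / 2) hL
  -- Neumann series: 1 + L = 1 - (-L) is invertible.
  have hL' : ‖-L'‖ < 1 := by
    rw [norm_neg]
    exact (L.mkContinuous_norm_le (by norm_num) hL).trans_lt (by norm_num)
  obtain ⟨u, hu⟩ := isUnit_one_sub_of_norm_lt_one hL'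
  let g' : lp (fun _ : ι => ℂ) 1 := ⟨fun i => g i * (w i : ℂ), (hmem g).1 hg⟩
  let x := (↑u⁻¹ : lp (fun _ : ι => ℂ) 1 →L[ℂ] lp (fun _ : ι => ℂ) 1) g'
  have hx : x + L x = g' := by
    have h : ((u : lp (fun _ : ι => ℂ) 1 →L[ℂ] lp (fun _ : ι => ℂ) 1) * ↑u⁻¹) g' = g' := by
      simp
    rw [hu] at h
    simpa [L', x] using h
  refine ⟨div x, hdivs x, ?_⟩
  ext i
  have h := congrArg (fun y : lp (fun _ : ι => ℂ) 1 => y i / (w i : ℂ)) hx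
  change (x i + T (div x) i * (w i : ℂ)) / (w i : ℂ) = g i * (w i : ℂ) / (w i : ℂ) at h
  rw [add_div, mul_div_cancel_right₀ _ (hw' i), mul_div_cancel_right₀ _ (hw' i)] at h
  exact h

/-! ## A multiplicative weight on monomials -/

section Weight

variable {σ : Type*} [Fintype σ]

/-- A distinct prime number for each variable. -/
noncomputable def variablePrime (i : σ) : ℕ :=
  Nat.nth Nat.Prime (Fintype.equivFin σ i)

theorem variablePrime_prime (i : σ) : (variablePrime i).Prime :=
  Nat.prime_nth_prime _

theorem variablePrime_injective : Function.Injective (variablePrime (σ := σ)) := fun _ _ h =>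
  (Fintype.equivFin σ).injective
    (Fin.ext (Nat.nth_injective Nat.infinite_setOfPred_prime h))

/-- The weight `∏ p_i ^ d_i` of the monomial `x ^ d`, where the `p_i` are distinct primes. -/
noncomputable def monomialWeight (d : σ →₀ ℕ) : ℕ :=
  d.prod fun i k => variablePrime i ^ k

theorem monomialWeight_add (d e : σ →₀ ℕ) :
    monomialWeight (d + e) = monomialWeight d * monomialWeight e := by
  classical
  exact Finsupp.prod_add_index' (fun _ => pow_zero _) (fun _ _ _ => pow_add _ _ _)

theorem monomialWeight_pos (d : σ →₀ ℕ) : 0 < monomialWeight d :=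
  Finset.prod_pos fun i _ => pow_pos (variablePrime_prime i).pos _

/-- Unique factorization recovers the exponents. Thus the weight is a multiplicative total ordering
of the monomials by integers. -/
theorem monomialWeight_injective : Function.Injective (monomialWeight (σ := σ)) := by
  have h : ∀ d : σ →₀ ℕ, (monomialWeight d).factorization = d.mapDomain variablePrime := by
    intro d
    have h1 : monomialWeight d = (d.mapDomain variablePrime).prod (· ^ ·) := by
      rw [Finsupp.prod_mapDomain_index (fun _ => pow_zero _) (fun _ _ _ => pow_add _ _ _)]
      rfl
    rw [h1]
    refine Nat.prod_pow_factorization_eq_self fun p hp => ?_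
    classical
    obtain ⟨i, -, rfl⟩ := Finset.mem_image.1 (Finsupp.mapDomain_support hp)
    exact variablePrime_prime i
  intro d e hde
  exact Finsupp.mapDomain_injective variablePrime_injective (by rw [← h, ← h, hde])

theorem two_pow_degree_le_monomialWeight (d : σ →₀ ℕ) : 2 ^ d.degree ≤ monomialWeight d := by
  rw [Finsupp.degree_apply, ← Finset.prod_pow_eq_pow_sum]
  exact Finset.prod_le_prod' fun i _ => Nat.pow_le_pow_left (variablePrime_prime i).two_le _

/-- With the lower bound 2 ^ degree, this makes convergence at the points p_i ^ (-s), for some s,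
equivalent to convergence on some polydisc. -/
theorem exists_monomialWeight_le_pow_degree :
    ∃ B : ℕ, 0 < B ∧ ∀ d : σ →₀ ℕ, monomialWeight d ≤ B ^ d.degree := by
  refine ⟨∏ i : σ, variablePrime i, Finset.prod_pos fun i _ => (variablePrime_prime i).pos,
    fun d => ?_⟩
  rw [Finsupp.degree_apply, ← Finset.prod_pow_eq_pow_sum]
  refine Finset.prod_le_prod' fun i _ => Nat.pow_le_pow_left ?_ _
  exact Finset.single_le_prod' (f := variablePrime)
    (fun j _ => (variablePrime_prime j).one_le) (Finset.mem_univ i)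

/-- The series `f` converges absolutely at the point with coordinates `p_i ^ (-s)`. -/
def WeightSummable (s : ℕ) (f : MvPowerSeries σ ℂ) : Prop :=
  Summable fun d : σ →₀ ℕ => ‖MvPowerSeries.coeff d f‖ * ((monomialWeight d : ℝ)⁻¹) ^ s

theorem inv_monomialWeight_pos (d : σ →₀ ℕ) : 0 < (monomialWeight d : ℝ)⁻¹ :=
  inv_pos.2 (by exact_mod_cast monomialWeight_pos d)

theorem inv_monomialWeight_le_one (d : σ →₀ ℕ) : (monomialWeight d : ℝ)⁻¹ ≤ 1 :=
  inv_le_one_of_one_le₀ (by exact_mod_cast monomialWeight_pos d)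

theorem WeightSummable.mono {s t : ℕ} (h : s ≤ t) {f : MvPowerSeries σ ℂ}
    (hf : WeightSummable s f) : WeightSummable t f :=
  Summable.of_nonneg_of_le
    (fun d => mul_nonneg (norm_nonneg _) (pow_nonneg (inv_monomialWeight_pos d).le _))
    (fun d => mul_le_mul_of_nonneg_left
      (pow_le_pow_of_le_one (inv_monomialWeight_pos d).le (inv_monomialWeight_le_one d) h)
      (norm_nonneg _)) hf

theorem WeightSummable.isConvergent {s : ℕ} {f : MvPowerSeries σ ℂ} (hf : WeightSummable s f) :
    f.IsConvergent := by
  obtain ⟨B, hB, h⟩ := exists_monomialWeight_le_pow_degree (σ := σ)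
  have hB' : (0 : ℝ) < B := by exact_mod_cast hB
  refine ⟨(B : ℝ)⁻¹ ^ s, by positivity, Summable.of_nonneg_of_le (fun _ => by positivity)
    (fun d => ?_) hf⟩
  refine mul_le_mul_of_nonneg_left ?_ (norm_nonneg _)
  rw [← pow_mul, mul_comm, pow_mul]
  refine pow_le_pow_left₀ (by positivity) ?_ _
  rw [inv_pow]
  refine inv_anti₀ (by exact_mod_cast monomialWeight_pos d) (by exact_mod_cast h d)

theorem MvPowerSeries.IsConvergent.exists_weightSummable {f : MvPowerSeries σ ℂ}
    (hf : f.IsConvergent) : ∃ s, WeightSummable s f := by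
  obtain ⟨r, hr, hf⟩ := hf
  obtain ⟨s, hs⟩ := exists_pow_lt_of_lt_one hr (by norm_num : (2 : ℝ)⁻¹ < 1)
  refine ⟨s, Summable.of_nonneg_of_le
    (fun d => mul_nonneg (norm_nonneg _) (pow_nonneg (inv_monomialWeight_pos d).le _))
    (fun d => mul_le_mul_of_nonneg_left ?_ (norm_nonneg _)) hf⟩
  calc ((monomialWeight d : ℝ)⁻¹) ^ s ≤ ((2 ^ d.degree : ℝ)⁻¹) ^ s := by
        refine pow_le_pow_left₀ (inv_monomialWeight_pos d).le ?_ _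
        exact inv_anti₀ (by positivity) (by exact_mod_cast two_pow_degree_le_monomialWeight d)
    _ = ((2 : ℝ)⁻¹ ^ s) ^ d.degree := by rw [← inv_pow, ← pow_mul, ← pow_mul, mul_comm]
    _ ≤ r ^ d.degree := pow_le_pow_left₀ (by positivity) hs.le _

/-- If `d` is the exponent of least weight in `f`, the other terms of `f` become small relative
to `x ^ d` at the points with coordinates `p_i ^ (-s)`, as `s` grows. -/
theorem exists_tail_le_half {f : MvPowerSeries σ ℂ} (hf : f.IsConvergent) (d : σ →₀ ℕ)
    (hd : MvPowerSeries.coeff d f = 0)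
    (hmin : ∀ e, MvPowerSeries.coeff e f ≠ 0 → monomialWeight d ≤ monomialWeight e) :
    ∃ s₀, ∀ s ≥ s₀, WeightSummable s f ∧
      ∑' e, ‖MvPowerSeries.coeff e f‖ * ((monomialWeight e : ℝ)⁻¹) ^ s ≤
        1 / 2 * ((monomialWeight d : ℝ)⁻¹) ^ s := by
  obtain ⟨s₁, hs₁⟩ := hf.exists_weightSummable
  set a : ℝ := (monomialWeight d : ℝ)⁻¹ with ha
  -- Weights are distinct integers, so every other term weighs at least one more than `d`. Raising s
  -- by k shrinks the tail by a factor b ^ k at least, but x ^ d only by a ^ k with b < a.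
  set b : ℝ := ((monomialWeight d + 1 : ℕ) : ℝ)⁻¹ with hb
  have ha0 : 0 < a := inv_monomialWeight_pos d
  have hb0 : 0 < b := inv_pos.2 (by positivity)
  have hba : b < a := by
    have : (0 : ℝ) < monomialWeight d := by exact_mod_cast monomialWeight_pos d
    exact inv_strictAnti₀ this (by push_cast; linarith)
  set C := ∑' e, ‖MvPowerSeries.coeff e f‖ * ((monomialWeight e : ℝ)⁻¹) ^ s₁ with hC
  have hC0 : 0 ≤ C := tsum_nonneg fun e =>
    mul_nonneg (norm_nonneg _) (pow_nonneg (inv_monomialWeight_pos e).le _)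
  have hlim : Filter.Tendsto (fun k : ℕ => (b / a) ^ k * C) Filter.atTop (nhds (0 * C)) :=
    (tendsto_pow_atTop_nhds_zero_of_lt_one (by positivity) ((div_lt_one ha0).2 hba)).mul_const C
  rw [zero_mul] at hlim
  obtain ⟨k₀, hk₀⟩ := Filter.eventually_atTop.1
    (hlim.eventually_lt_const (show 0 < 1 / 2 * a ^ s₁ by positivity))
  refine ⟨s₁ + k₀, fun s hs => ⟨hs₁.mono (by omega), ?_⟩⟩
  obtain ⟨k, rfl⟩ : ∃ k, s = s₁ + k := ⟨s - s₁, by omega⟩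
  have hk := hk₀ k (by omega)
  have hle : ∀ e, ‖MvPowerSeries.coeff e f‖ * ((monomialWeight e : ℝ)⁻¹) ^ (s₁ + k) ≤
      b ^ k * (‖MvPowerSeries.coeff e f‖ * ((monomialWeight e : ℝ)⁻¹) ^ s₁) := by
    intro e
    by_cases h0 : MvPowerSeries.coeff e f = 0
    · simp [h0]
    have hne : monomialWeight d ≠ monomialWeight e := fun h =>
      h0 (by rwa [← monomialWeight_injective h])
    have h1 : monomialWeight d + 1 ≤ monomialWeight e := lt_of_le_of_ne (hmin e h0) hne
    have h2 : (monomialWeight e : ℝ)⁻¹ ≤ b :=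
      inv_anti₀ (by positivity) (by exact_mod_cast h1)
    have h3 := pow_le_pow_left₀ (inv_monomialWeight_pos e).le h2 k
    rw [pow_add]
    have h4 : 0 ≤ ‖MvPowerSeries.coeff e f‖ * ((monomialWeight e : ℝ)⁻¹) ^ s₁ :=
      mul_nonneg (norm_nonneg _) (pow_nonneg (inv_monomialWeight_pos e).le _)
    nlinarith [mul_le_mul_of_nonneg_left h3 h4]
  calc ∑' e, ‖MvPowerSeries.coeff e f‖ * ((monomialWeight e : ℝ)⁻¹) ^ (s₁ + k)
      ≤ ∑' e, b ^ k * (‖MvPowerSeries.coeff e f‖ * ((monomialWeight e : ℝ)⁻¹) ^ s₁) :=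
        Summable.tsum_le_tsum hle (hs₁.mono (by omega)) (hs₁.mul_left _)
    _ = b ^ k * C := tsum_mul_left
    _ = (b / a) ^ k * C * a ^ k := by rw [div_pow]; field_simp
    _ ≤ 1 / 2 * a ^ s₁ * a ^ k := by gcongr
    _ = 1 / 2 * a ^ (s₁ + k) := by ring

/-- The norm of a product of two series at the point with coordinates `p_i ^ (-s)`. -/
theorem WeightSummable.mul {s : ℕ} {f g : MvPowerSeries σ ℂ} (hf : WeightSummable s f)
    (hg : WeightSummable s g) : WeightSummable s (f * g) ∧
      ∑' e, ‖MvPowerSeries.coeff e (f * g)‖ * ((monomialWeight e : ℝ)⁻¹) ^ s ≤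
        (∑' e, ‖MvPowerSeries.coeff e f‖ * ((monomialWeight e : ℝ)⁻¹) ^ s) *
          ∑' e, ‖MvPowerSeries.coeff e g‖ * ((monomialWeight e : ℝ)⁻¹) ^ s := by
  classical
  have h0 : ∀ (f : MvPowerSeries σ ℂ) (d : σ →₀ ℕ),
      0 ≤ ‖MvPowerSeries.coeff d f‖ * ((monomialWeight d : ℝ)⁻¹) ^ s := fun f d =>
    mul_nonneg (norm_nonneg _) (pow_nonneg (inv_monomialWeight_pos d).le _)
  have hp := Summable.mul_of_nonneg hf hg (h0 f) (h0 g)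
  have hsum := summable_sum_mul_antidiagonal_of_summable_mul
      (f := fun d : σ →₀ ℕ => ‖MvPowerSeries.coeff d f‖ * ((monomialWeight d : ℝ)⁻¹) ^ s)
      (g := fun d : σ →₀ ℕ => ‖MvPowerSeries.coeff d g‖ * ((monomialWeight d : ℝ)⁻¹) ^ s) hp
  have hle : ∀ d, ‖MvPowerSeries.coeff d (f * g)‖ * ((monomialWeight d : ℝ)⁻¹) ^ s ≤
      ∑ x ∈ Finset.HasAntidiagonal.antidiagonal d,
        (‖MvPowerSeries.coeff x.1 f‖ * ((monomialWeight x.1 : ℝ)⁻¹) ^ s) *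
          (‖MvPowerSeries.coeff x.2 g‖ * ((monomialWeight x.2 : ℝ)⁻¹) ^ s) := by
    intro d
    have h1 : ‖MvPowerSeries.coeff d (f * g)‖ ≤ ∑ x ∈ Finset.HasAntidiagonal.antidiagonal d,
        ‖MvPowerSeries.coeff x.1 f‖ * ‖MvPowerSeries.coeff x.2 g‖ := by
      rw [MvPowerSeries.coeff_mul]
      exact norm_sum_le_of_le _ fun x _ => norm_mul_le _ _
    refine (mul_le_mul_of_nonneg_right h1
      (pow_nonneg (inv_monomialWeight_pos d).le _)).trans (le_of_eq ?_)
    rw [Finset.sum_mul]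
    refine Finset.sum_congr rfl fun x hx => ?_
    rw [← Finset.HasAntidiagonal.mem_antidiagonal.mp hx, monomialWeight_add, Nat.cast_mul,
      mul_inv, mul_pow]
    ring
  have hfg : WeightSummable s (f * g) := Summable.of_nonneg_of_le (h0 _) hle hsum
  refine ⟨hfg, ?_⟩
  have heq := Summable.tsum_mul_tsum_eq_tsum_sum_antidiagonal hf hg hp
  exact (Summable.tsum_le_tsum hle hfg hsum).trans heq.ge

end Weight

/-! ### Division with remainder for convergent power series -/

section Division

variable {σ : Type*}

open Classical in
/-- An index `i` with `x ^ d_i ∣ x ^ e`, if there is one. -/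
noncomputable def divisorIndex {κ : Type*} (d : κ → σ →₀ ℕ) (e : σ →₀ ℕ) : Option κ :=
  if h : ∃ i, d i ≤ e then some h.choose else none

theorem le_of_divisorIndex_eq_some {κ : Type*} {d : κ → σ →₀ ℕ} {e : σ →₀ ℕ} {i : κ}
    (h : divisorIndex d e = some i) : d i ≤ e := by
  unfold divisorIndex at h
  split_ifs at h with h'
  obtain rfl := Option.some.inj h
  exact h'.choose_spec

theorem divisorIndex_ne_none {κ : Type*} {d : κ → σ →₀ ℕ} {e : σ →₀ ℕ} {i : κ}
    (h : d i ≤ e) : divisorIndex d e ≠ none := by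
  unfold divisorIndex
  rw [dif_pos ⟨i, h⟩]
  exact Option.some_ne_none _

open Classical in
/-- The quotient by `x ^ d_i` in the monomial division by the family `x ^ d`. -/
noncomputable def monomialQuotient {κ : Type*} (d : κ → σ →₀ ℕ) (i : κ) :
    MvPowerSeries σ ℂ →ₗ[ℂ] MvPowerSeries σ ℂ where
  toFun G := fun a => if divisorIndex d (a + d i) = some i then G (a + d i) else 0
  map_add' F G := by
    ext a
    change (if _ then F (a + d i) + G (a + d i) else 0) = (if _ then _ else 0) + (if _ then _ else 0)
    split_ifs <;> simp
  map_smul' c G := by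
    ext a
    change (if _ then c * G (a + d i) else 0) = c * (if _ then _ else 0)
    split_ifs <;> simp

open Classical in
theorem coeff_monomialQuotient {κ : Type*} (d : κ → σ →₀ ℕ) (i : κ) (G : MvPowerSeries σ ℂ)
    (a : σ →₀ ℕ) : MvPowerSeries.coeff a (monomialQuotient d i G) =
      if divisorIndex d (a + d i) = some i then MvPowerSeries.coeff (a + d i) G else 0 :=
  rfl

open Classical in
/-- The remainder in the monomial division by the family `x ^ d`. -/
noncomputable def monomialRemainder {κ : Type*} (d : κ → σ →₀ ℕ) (G : MvPowerSeries σ ℂ) :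
    MvPowerSeries σ ℂ :=
  fun e => if divisorIndex d e = none then MvPowerSeries.coeff e G else 0

open Classical in
theorem coeff_monomialRemainder {κ : Type*} (d : κ → σ →₀ ℕ) (G : MvPowerSeries σ ℂ)
    (e : σ →₀ ℕ) : MvPowerSeries.coeff e (monomialRemainder d G) =
      if divisorIndex d e = none then MvPowerSeries.coeff e G else 0 :=
  rfl

/-- `divisorIndex` sends each exponent to exactly one quotient or to the remainder, so no term is
counted twice. -/
theorem sum_monomialQuotient_mul_add_monomialRemainder {κ : Type*} [Fintype κ]
    (d : κ → σ →₀ ℕ) (G : MvPowerSeries σ ℂ) :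
    ∑ i, monomialQuotient d i G * MvPowerSeries.monomial (d i) 1 + monomialRemainder d G = G := by
  classical
  ext e
  have h : ∀ i, MvPowerSeries.coeff e (monomialQuotient d i G * MvPowerSeries.monomial (d i) 1) =
      if divisorIndex d e = some i then MvPowerSeries.coeff e G else 0 := by
    intro i
    rw [MvPowerSeries.coeff_mul_monomial, coeff_monomialQuotient]
    by_cases hi : d i ≤ e
    · rw [if_pos hi, tsub_add_cancel_of_le hi, mul_one]
    · rw [if_neg hi, if_neg fun h => hi (le_of_divisorIndex_eq_some h)]
  rw [map_add, map_sum, Finset.sum_congr rfl fun i _ => h i, coeff_monomialRemainder]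
  cases divisorIndex d e <;> simp

variable [Fintype σ]

theorem WeightSummable.sum {κ : Type*} (t : Finset κ) {s : ℕ} {f : κ → MvPowerSeries σ ℂ}
    (hf : ∀ i ∈ t, WeightSummable s (f i)) : WeightSummable s (∑ i ∈ t, f i) ∧
      ∑' e, ‖MvPowerSeries.coeff e (∑ i ∈ t, f i)‖ * ((monomialWeight e : ℝ)⁻¹) ^ s ≤
        ∑ i ∈ t, ∑' e, ‖MvPowerSeries.coeff e (f i)‖ * ((monomialWeight e : ℝ)⁻¹) ^ s := by
  have hle : ∀ e, ‖MvPowerSeries.coeff e (∑ i ∈ t, f i)‖ * ((monomialWeight e : ℝ)⁻¹) ^ s ≤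
      ∑ i ∈ t, ‖MvPowerSeries.coeff e (f i)‖ * ((monomialWeight e : ℝ)⁻¹) ^ s := by
    intro e
    rw [map_sum, ← Finset.sum_mul]
    exact mul_le_mul_of_nonneg_right (norm_sum_le _ _) (pow_nonneg (inv_monomialWeight_pos e).le _)
  have hs := summable_sum hf
  have h1 : WeightSummable s (∑ i ∈ t, f i) := Summable.of_nonneg_of_le
    (fun e => mul_nonneg (norm_nonneg _) (pow_nonneg (inv_monomialWeight_pos e).le _)) hle hs
  refine ⟨h1, ?_⟩
  rw [← Summable.tsum_finsetSum hf]
  exact Summable.tsum_le_tsum hle h1 hs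

theorem weightSummable_monomialQuotient {κ : Type*} (d : κ → σ →₀ ℕ) {s : ℕ}
    {G : MvPowerSeries σ ℂ} (hG : WeightSummable s G) (i : κ) :
    WeightSummable s (monomialQuotient d i G) := by
  classical
  have hc : 0 < ((monomialWeight (d i) : ℝ)⁻¹) ^ s := pow_pos (inv_monomialWeight_pos _) _
  have h := (hG.comp_injective (add_left_injective (d i))).mul_left
    ((((monomialWeight (d i) : ℝ)⁻¹) ^ s)⁻¹)
  refine Summable.of_nonneg_of_le
    (fun e => mul_nonneg (norm_nonneg _) (pow_nonneg (inv_monomialWeight_pos e).le _))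
    (fun e => ?_) h
  have h1 : ‖MvPowerSeries.coeff e (monomialQuotient d i G)‖ ≤
      ‖MvPowerSeries.coeff (e + d i) G‖ := by
    rw [coeff_monomialQuotient]
    split_ifs <;> simp
  refine (mul_le_mul_of_nonneg_right h1 (pow_nonneg (inv_monomialWeight_pos e).le _)).trans
    (le_of_eq ?_)
  simp only [Function.comp_apply, monomialWeight_add, Nat.cast_mul, mul_inv, mul_pow]
  rw [eq_inv_mul_iff_mul_eq₀ (by simpa using hc.ne')]
  ring

/-- The quotients use disjoint sets of terms of G, and multiplication by x ^ d_i scales the norm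
exactly by the weight factor. Hence the bound does not grow with the number of divisors. -/
theorem sum_tsum_monomialQuotient_le {κ : Type*} [Fintype κ] (d : κ → σ →₀ ℕ) {s : ℕ}
    {G : MvPowerSeries σ ℂ} (hG : WeightSummable s G) :
    ∑ i, (∑' e, ‖MvPowerSeries.coeff e (monomialQuotient d i G)‖ *
        ((monomialWeight e : ℝ)⁻¹) ^ s) * ((monomialWeight (d i) : ℝ)⁻¹) ^ s ≤
      ∑' e, ‖MvPowerSeries.coeff e G‖ * ((monomialWeight e : ℝ)⁻¹) ^ s := by
  classical
  let φ : κ → (σ →₀ ℕ) → ℝ := fun i e =>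
    if divisorIndex d e = some i then
      ‖MvPowerSeries.coeff e G‖ * ((monomialWeight e : ℝ)⁻¹) ^ s else 0
  have h0 : ∀ e : σ →₀ ℕ, 0 ≤ ‖MvPowerSeries.coeff e G‖ * ((monomialWeight e : ℝ)⁻¹) ^ s :=
    fun e => mul_nonneg (norm_nonneg _) (pow_nonneg (inv_monomialWeight_pos e).le _)
  have hφ0 : ∀ i e, 0 ≤ φ i e := fun i e => by
    simp only [φ]; split_ifs <;> first | exact h0 e | exact le_rfl
  have hφle : ∀ i e, φ i e ≤ ‖MvPowerSeries.coeff e G‖ * ((monomialWeight e : ℝ)⁻¹) ^ s :=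
    fun i e => by simp only [φ]; split_ifs <;> first | exact le_rfl | exact h0 e
  have hφs : ∀ i, Summable (φ i) := fun i => Summable.of_nonneg_of_le (hφ0 i) (hφle i) hG
  have h1 : ∀ i, (∑' e, ‖MvPowerSeries.coeff e (monomialQuotient d i G)‖ *
        ((monomialWeight e : ℝ)⁻¹) ^ s) * ((monomialWeight (d i) : ℝ)⁻¹) ^ s ≤ ∑' e, φ i e := by
    intro i
    rw [← tsum_mul_right]
    have h2 : ∀ e, ‖MvPowerSeries.coeff e (monomialQuotient d i G)‖ *
        ((monomialWeight e : ℝ)⁻¹) ^ s * ((monomialWeight (d i) : ℝ)⁻¹) ^ s = φ i (e + d i) := by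
      intro e
      simp only [φ, coeff_monomialQuotient]
      split_ifs
      · rw [monomialWeight_add, Nat.cast_mul, mul_inv, mul_pow, mul_assoc]
      · simp
    simp_rw [h2]
    exact tsum_comp_le_tsum_of_inj (hφs i) (hφ0 i) (add_left_injective (d i))
  refine (Finset.sum_le_sum fun i _ => h1 i).trans ?_
  rw [← Summable.tsum_finsetSum fun i _ => hφs i]
  refine Summable.tsum_le_tsum (fun e => ?_) (summable_sum fun i _ => hφs i) hG
  simp only [φ]
  cases divisorIndex d e
  · simpa using h0 e
  · simp

/-- Division with remainder in the ring of convergent power series: if `x ^ d_i` is the term of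
least weight of `f_i`, every `g` is a combination of the `f_i` up to a remainder without terms
divisible by some `x ^ d_i`. -/
theorem MvPowerSeries.IsConvergent.exists_division {κ : Type*} [Fintype κ]
    {f : κ → MvPowerSeries σ ℂ} (hf : ∀ i, (f i).IsConvergent) (d : κ → σ →₀ ℕ)
    (hd : ∀ i, MvPowerSeries.coeff (d i) (f i) = 1)
    (hmin : ∀ i e, MvPowerSeries.coeff e (f i) ≠ 0 → monomialWeight (d i) ≤ monomialWeight e)
    {g : MvPowerSeries σ ℂ} (hg : g.IsConvergent) :
    ∃ (q : κ → MvPowerSeries σ ℂ) (r : MvPowerSeries σ ℂ), (∀ i, (q i).IsConvergent) ∧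
      r.IsConvergent ∧ g = ∑ i, q i * f i + r ∧
        ∀ i e, d i ≤ e → MvPowerSeries.coeff e r = 0 := by
  classical
  let h : κ → MvPowerSeries σ ℂ := fun i => f i - MvPowerSeries.monomial (d i) 1
  have hh : ∀ i, (h i).IsConvergent := fun i => by
    have : (MvPowerSeries.monomial (d i) (1 : ℂ)).IsConvergent :=
      ⟨1, one_pos, MvPowerSeries.summable_of_eq_zero 1 (d i) fun e he => by
        rw [MvPowerSeries.coeff_monomial, if_neg he]⟩
    exact (convergentSubalgebra σ).sub_mem (hf i) this
  have hcoeff : ∀ i e, MvPowerSeries.coeff e (h i) =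
      if e = d i then 0 else MvPowerSeries.coeff e (f i) := fun i e => by
    simp only [h, map_sub, MvPowerSeries.coeff_monomial]
    split_ifs with he
    · rw [he, hd, sub_self]
    · rw [sub_zero]
  choose s₀ hs₀ using fun i => exists_tail_le_half (hh i) (d i) (by rw [hcoeff, if_pos rfl])
    fun e he => by
      rw [hcoeff] at he
      split_ifs at he with hed
      · exact absurd rfl he
      · exact hmin i e he
  obtain ⟨s₁, hs₁⟩ := hg.exists_weightSummable
  let s := s₁ + ∑ i, s₀ i
  have hss : ∀ i, s₀ i ≤ s := fun i =>
    (Finset.single_le_sum (fun _ _ => Nat.zero_le _) (Finset.mem_univ i)).trans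
      (Nat.le_add_left _ _)
  have htail := fun i => hs₀ i s (hss i)
  -- Monomial division of G with x ^ d_i replaced by f_i = x ^ d_i + h_i gives G + T G in place of
  -- G. So one solves G + T G = g and divides G by monomials; the tails h_i being small makes T a
  -- contraction.
  let T : MvPowerSeries σ ℂ →ₗ[ℂ] MvPowerSeries σ ℂ :=
    ∑ i, (LinearMap.mulRight ℂ (h i)).comp (monomialQuotient d i)
  have hTapp : ∀ G, T G = ∑ i, monomialQuotient d i G * h i := fun G => by
    simp [T, LinearMap.sum_apply]
  have hT : ∀ G : MvPowerSeries σ ℂ, WeightSummable s G → WeightSummable s (T G) ∧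
      ∑' e, ‖MvPowerSeries.coeff e (T G)‖ * ((monomialWeight e : ℝ)⁻¹) ^ s ≤
        1 / 2 * ∑' e, ‖MvPowerSeries.coeff e G‖ * ((monomialWeight e : ℝ)⁻¹) ^ s := by
    intro G hG
    rw [hTapp]
    have hQ := fun i => weightSummable_monomialQuotient d hG i
    have hm := fun i => (hQ i).mul (htail i).1
    obtain ⟨h1, h2⟩ := WeightSummable.sum Finset.univ fun i _ => (hm i).1
    refine ⟨h1, h2.trans ?_⟩
    refine le_trans (Finset.sum_le_sum fun i _ => (hm i).2.trans
      (mul_le_mul_of_nonneg_left (htail i).2 (tsum_nonneg fun e =>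
        mul_nonneg (norm_nonneg _) (pow_nonneg (inv_monomialWeight_pos e).le _)))) ?_
    refine le_trans (le_of_eq ?_)
      (mul_le_mul_of_nonneg_left (sum_tsum_monomialQuotient_le d hG) (by norm_num))
    rw [Finset.mul_sum]
    exact Finset.sum_congr rfl fun i _ => by ring
  obtain ⟨G, hG, hGT⟩ : ∃ G : MvPowerSeries σ ℂ, WeightSummable s G ∧ G + T G = g :=
    exists_add_map_eq_of_norm_le_half (fun e : σ →₀ ℕ => ((monomialWeight e : ℝ)⁻¹) ^ s)
    (fun e => pow_pos (inv_monomialWeight_pos e) _) T hT g (hs₁.mono (Nat.le_add_right _ _))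
  refine ⟨fun i => monomialQuotient d i G, monomialRemainder d G,
    fun i => (weightSummable_monomialQuotient d hG i).isConvergent, ?_, ?_, fun i e hie => ?_⟩
  · refine WeightSummable.isConvergent (s := s) (Summable.of_nonneg_of_le
      (fun e => mul_nonneg (norm_nonneg _) (pow_nonneg (inv_monomialWeight_pos e).le _))
      (fun e => mul_le_mul_of_nonneg_right ?_ (pow_nonneg (inv_monomialWeight_pos e).le _)) hG)
    rw [coeff_monomialRemainder]
    split_ifs <;> simp
  · have h1 := sum_monomialQuotient_mul_add_monomialRemainder d G
    have h2 : ∑ i, monomialQuotient d i G * f i =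
        ∑ i, monomialQuotient d i G * MvPowerSeries.monomial (d i) 1 + T G := by
      rw [hTapp, ← Finset.sum_add_distrib]
      exact Finset.sum_congr rfl fun i _ => by simp only [h]; ring
    calc g = G + T G := hGT.symm
      _ = _ := by
        rw [h2, add_right_comm, h1]
  · rw [coeff_monomialRemainder, if_neg (divisorIndex_ne_none hie)]

end Division

/-! ### The ring of convergent power series is local and noetherian -/

namespace ConvergentSeries

variable {σ : Type*}

theorem toMvPowerSeries_injective : Function.Injective (toMvPowerSeries σ) :=
  Subtype.val_injective

theorem exists_toMvPowerSeries_eq {f : MvPowerSeries σ ℂ} (hf : f.IsConvergent) :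
    ∃ g, toMvPowerSeries σ g = f :=
  ⟨⟨f, hf⟩, rfl⟩

/-- The coefficient of `x ^ d`. -/
noncomputable def coeff (d : σ →₀ ℕ) : ConvergentSeries σ →ₗ[ℂ] ℂ :=
  (MvPowerSeries.coeff d).comp (toMvPowerSeries σ).toLinearMap

@[ext]
theorem ext_coeff {f g : ConvergentSeries σ} (h : ∀ d, coeff d f = coeff d g) : f = g :=
  Subtype.ext (MvPowerSeries.ext h)

theorem coeff_mul [DecidableEq σ] (d : σ →₀ ℕ) (f g : ConvergentSeries σ) :
    coeff d (f * g) = ∑ x ∈ Finset.HasAntidiagonal.antidiagonal d, coeff x.1 f * coeff x.2 g :=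
  MvPowerSeries.coeff_mul d _ _

theorem coeff_coord [DecidableEq σ] (d : σ →₀ ℕ) (i : σ) :
    coeff d (coord i) = if d = Finsupp.single i 1 then 1 else 0 :=
  MvPowerSeries.coeff_X d i

theorem coeff_pderiv (d : σ →₀ ℕ) (i : σ) (f : ConvergentSeries σ) :
    coeff d (pderiv i f) = coeff (d + Finsupp.single i 1) f * (d i + 1) :=
  MvPowerSeries.coeff_pderiv f.1 d

theorem coeff_coord_mul [DecidableEq σ] (d : σ →₀ ℕ) (i : σ) (f : ConvergentSeries σ) :
    coeff (Finsupp.single i 1 + d) (coord i * f) = coeff d f :=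
  (MvPowerSeries.coeff_add_monomial_mul (Finsupp.single i 1) d f.1 (1 : ℂ)).trans (one_mul _)

theorem coeff_coord_mul_of_not_le (d : σ →₀ ℕ) (i : σ) (h : d i = 0) (f : ConvergentSeries σ) :
    coeff d (coord i * f) = 0 := by
  classical
  refine (MvPowerSeries.coeff_monomial_mul d (Finsupp.single i 1) f.1 (1 : ℂ)).trans (if_neg ?_)
  intro hle
  have := hle i
  simp [h] at this

/-- The value of a germ at the origin. -/
noncomputable def eval₀ : ConvergentSeries σ →ₐ[ℂ] ℂ where
  toFun f := MvPowerSeries.constantCoeff f.1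
  map_one' := map_one _
  map_mul' f g := map_mul MvPowerSeries.constantCoeff f.1 g.1
  map_zero' := map_zero _
  map_add' f g := map_add MvPowerSeries.constantCoeff f.1 g.1
  commutes' c := MvPowerSeries.constantCoeff_C c

theorem eval₀_apply (f : ConvergentSeries σ) : eval₀ f = coeff 0 f := rfl

theorem eval₀_coord (i : σ) : eval₀ (coord i) = 0 := by
  classical
  rw [eval₀_apply, coeff_coord, if_neg]
  intro h
  simpa using (DFunLike.congr_fun h i)

/-- Every term of a member of the ideal is divisible by some x_i with i in `s`. This is what forces
remainders free of these variables to vanish. -/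
theorem coeff_eq_zero_of_mem_span_coord {s : Set σ} {f : ConvergentSeries σ}
    (hf : f ∈ Ideal.span (coord '' s)) (e : σ →₀ ℕ) (he : ∀ i ∈ s, e i = 0) :
    coeff e f = 0 := by
  classical
  refine Submodule.span_induction (p := fun f _ => ∀ e : σ →₀ ℕ, (∀ i ∈ s, e i = 0) →
    coeff e f = 0) ?_ ?_ ?_ ?_ hf e he
  · rintro _ ⟨i, hi, rfl⟩ e he
    rw [← mul_one (coord i)]
    exact coeff_coord_mul_of_not_le e i (he i hi) 1
  · intro e _
    exact map_zero _
  · intro f g _ _ hf hg e he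
    rw [map_add, hf e he, hg e he, add_zero]
  · intro a f _ hf e he
    rw [smul_eq_mul, coeff_mul]
    refine Finset.sum_eq_zero fun x hx => ?_
    rw [hf x.2 fun i hi => ?_, mul_zero]
    have := he i hi
    rw [← Finset.HasAntidiagonal.mem_antidiagonal.1 hx, Finsupp.add_apply] at this
    omega

section Fintype

variable [Fintype σ]

theorem exists_division {κ : Type*} [Fintype κ] (f : κ → ConvergentSeries σ) (d : κ → σ →₀ ℕ)
    (hd : ∀ i, coeff (d i) (f i) = 1)
    (hmin : ∀ i e, coeff e (f i) ≠ 0 → monomialWeight (d i) ≤ monomialWeight e)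
    (g : ConvergentSeries σ) :
    ∃ (q : κ → ConvergentSeries σ) (r : ConvergentSeries σ), g = ∑ i, q i * f i + r ∧
      ∀ i e, d i ≤ e → coeff e r = 0 := by
  obtain ⟨q, r, hq, hr, h1, h2⟩ := MvPowerSeries.IsConvergent.exists_division
    (f := fun i => (f i).1) (fun i => (f i).2) d hd hmin g.2
  choose q' hq' using fun i => exists_toMvPowerSeries_eq (hq i)
  obtain ⟨r, rfl⟩ := exists_toMvPowerSeries_eq hr
  refine ⟨q', r, ?_, h2⟩
  apply toMvPowerSeries_injective
  rw [map_add, map_sum]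
  simp only [map_mul, hq']
  exact h1

theorem monomialWeight_zero : monomialWeight (0 : σ →₀ ℕ) = 1 := Finsupp.prod_zero_index

/-- The leading exponent of f is 0, which divides every monomial, so dividing 1 by the normalized f
leaves no remainder. -/
theorem isUnit_of_eval₀_ne_zero {f : ConvergentSeries σ} (hf : eval₀ f ≠ 0) : IsUnit f := by
  have hd : coeff 0 ((eval₀ f)⁻¹ • f) = 1 := by
    rw [map_smul, smul_eq_mul, ← eval₀_apply, inv_mul_cancel₀ hf]
  obtain ⟨q, r, h1, h2⟩ := exists_division (fun _ : Unit => (eval₀ f)⁻¹ • f) (fun _ => 0)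
    (fun _ => hd) (fun _ e _ => by rw [monomialWeight_zero]; exact monomialWeight_pos e) 1
  have hr : r = 0 := ext_coeff fun e => by rw [h2 () e (zero_le), map_zero]
  refine IsUnit.of_mul_eq_one ((eval₀ f)⁻¹ • q ()) ?_
  rw [h1, hr]
  simp [mul_comm]

theorem isUnit_iff {f : ConvergentSeries σ} : IsUnit f ↔ eval₀ f ≠ 0 :=
  ⟨fun h => (h.map eval₀).ne_zero, isUnit_of_eval₀_ne_zero⟩

instance : Nontrivial (ConvergentSeries σ) :=
  (eval₀ (σ := σ)).toRingHom.domain_nontrivial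

instance : IsLocalRing (ConvergentSeries σ) :=
  IsLocalRing.of_nonunits_add fun f g hf hg => by
    rw [mem_nonunits_iff, isUnit_iff, not_not] at *
    rw [map_add, hf, hg, add_zero]

theorem mem_maximalIdeal {f : ConvergentSeries σ} :
    f ∈ IsLocalRing.maximalIdeal (ConvergentSeries σ) ↔ eval₀ f = 0 := by
  rw [IsLocalRing.mem_maximalIdeal, mem_nonunits_iff, isUnit_iff, not_not]

/-- Division by coordinates: modulo the ideal generated by the coordinates `x_i`, `i ∈ s`, every
germ is equivalent to a series in the other variables. -/
theorem exists_sub_mem_span_coord (s : Finset σ) (g : ConvergentSeries σ) :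
    ∃ r : ConvergentSeries σ, g - r ∈ Ideal.span (coord '' (s : Set σ)) ∧
      ∀ i ∈ s, ∀ e : σ →₀ ℕ, e i ≠ 0 → coeff e r = 0 := by
  classical
  obtain ⟨q, r, h1, h2⟩ := exists_division (fun i : s => coord (i : σ))
    (fun i => Finsupp.single (i : σ) 1) (fun i => by rw [coeff_coord, if_pos rfl])
    (fun i e he => by
      rw [coeff_coord] at he
      split_ifs at he with h
      · rw [h]
      · exact absurd rfl he) g
  refine ⟨r, ?_, fun i hi e he => h2 ⟨i, hi⟩ e ?_⟩
  · rw [h1, add_sub_cancel_right]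
    exact Ideal.sum_mem _ fun i _ => Ideal.mul_mem_left _ _
      (Ideal.subset_span ⟨i, i.2, rfl⟩)
  · rw [Finsupp.single_le_iff]
    exact Nat.one_le_iff_ne_zero.2 he

/-- Division by all the coordinates leaves a constant, which is the value at the origin. -/
theorem maximalIdeal_eq_span :
    IsLocalRing.maximalIdeal (ConvergentSeries σ) = Ideal.span (Set.range coord) := by
  classical
  apply le_antisymm
  · intro f hf
    rw [mem_maximalIdeal] at hf
    obtain ⟨r, h1, h2⟩ := exists_sub_mem_span_coord Finset.univ f
    rw [Finset.coe_univ, Set.image_univ] at h1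
    have h3 : coeff 0 (f - r) = 0 := by
      rw [← Set.image_univ] at h1
      exact coeff_eq_zero_of_mem_span_coord h1 0 fun i _ => rfl
    have hr : r = 0 := ext_coeff fun e => by
      rw [map_zero]
      by_cases he : e = 0
      · rw [he]
        rw [map_sub, ← eval₀_apply, hf, zero_sub, neg_eq_zero] at h3
        exact h3
      · obtain ⟨i, hi⟩ := Finsupp.ne_iff.1 he
        exact h2 i (Finset.mem_univ i) e hi
    rwa [hr, sub_zero] at h1
  · rw [Ideal.span_le]
    rintro _ ⟨i, rfl⟩
    exact mem_maximalIdeal.2 (eval₀_coord i)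

/-- The coordinates form a regular sequence, in any order. -/
theorem mem_span_of_coord_mul_mem_span {s : Finset σ} {i : σ} (hi : i ∉ s)
    {f : ConvergentSeries σ} (hf : coord i * f ∈ Ideal.span (coord '' (s : Set σ))) :
    f ∈ Ideal.span (coord '' (s : Set σ)) := by
  classical
  obtain ⟨r, h1, h2⟩ := exists_sub_mem_span_coord s f
  have h3 : coord i * r ∈ Ideal.span (coord '' (s : Set σ)) := by
    have := Ideal.sub_mem _ hf (Ideal.mul_mem_left _ (coord i) h1)
    rwa [mul_sub, sub_sub_cancel] at this
  -- The remainder r involves no variable from `s`. The coefficients of x_i r are shifts of those of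
  -- r, and at exponents free of `s` they vanish.
  have hr : r = 0 := ext_coeff fun e => by
    rw [map_zero]
    by_cases he : ∃ j ∈ s, e j ≠ 0
    · obtain ⟨j, hj, hje⟩ := he
      exact h2 j hj e hje
    · push Not at he
      rw [← coeff_coord_mul e i r]
      refine coeff_eq_zero_of_mem_span_coord h3 _ fun j hj => ?_
      have hij : i ≠ j := fun h => hi (h ▸ hj)
      simp [he j hj, hij]
  rwa [hr, sub_zero] at h1

/-- The exponent of the term of least weight. -/
theorem exists_leading_exponent {f : ConvergentSeries σ} (hf : f ≠ 0) :
    ∃ d, coeff d f ≠ 0 ∧ ∀ e, coeff e f ≠ 0 → monomialWeight d ≤ monomialWeight e := by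
  have hne : {d | coeff d f ≠ 0}.Nonempty := by
    by_contra h
    rw [Set.not_nonempty_iff_eq_empty] at h
    exact hf (ext_coeff fun d => by
      by_contra hd
      exact (h ▸ (show d ∈ {d | coeff d f ≠ 0} by simpa using hd) : d ∈ (∅ : Set _)))
  obtain ⟨d, hd, hmin⟩ := (measure (monomialWeight (σ := σ))).wf.has_min _ hne
  exact ⟨d, hd, fun e he => not_lt.1 (hmin e he)⟩

/-- The ring of convergent power series is noetherian. -/
instance : IsNoetherianRing (ConvergentSeries σ) := by
  classical
  refine ⟨fun I => ?_⟩
  let L : Set (σ →₀ ℕ) := {d | ∃ f ∈ I, coeff d f = 1 ∧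
    ∀ e, coeff e f ≠ 0 → monomialWeight d ≤ monomialWeight e}
  -- Dickson's lemma: the leading exponents of I have finitely many minimal elements, and the germs
  -- realizing these will generate I.
  have hpwo : L.IsPWO := Set.isPWO_of_wellQuasiOrderedLE L
  obtain ⟨S, hSL, hS⟩ : ∃ S : Finset (σ →₀ ℕ), (S : Set (σ →₀ ℕ)) ⊆ L ∧
      ∀ e ∈ L, ∃ d ∈ S, d ≤ e := by
    have hfin : {d | Minimal (· ∈ L) d}.Finite :=
      (setOfPred_minimal_antichain (· ∈ L)).finite_of_partiallyWellOrderedOn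
        (hpwo.mono fun d hd => hd.1)
    refine ⟨hfin.toFinset, fun d hd => ?_, fun e he => ?_⟩
    · exact ((hfin.mem_toFinset).1 hd).1
    · obtain ⟨d, hde, hd⟩ := hpwo.exists_le_minimal he
      exact ⟨d, hfin.mem_toFinset.2 hd, hde⟩
  choose f hfI hf1 hfmin using fun d : S => hSL d.2
  have hI : I = Ideal.span (Set.range f) := by
    apply le_antisymm
    · intro g hg
      obtain ⟨q, r, h1, h2⟩ := exists_division f (fun d : S => (d : σ →₀ ℕ)) hf1 hfmin g
      have hsum : ∑ i, q i * f i ∈ Ideal.span (Set.range f) :=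
        Ideal.sum_mem _ fun i _ => Ideal.mul_mem_left _ _ (Ideal.subset_span ⟨i, rfl⟩)
      -- A nonzero remainder would lie in I, so its leading exponent would be divisible by one in
      -- `S`, contrary to the division.
      have hr : r = 0 := by
        by_contra hr0
        have hrI : r ∈ I := by
          have : r = g - ∑ i, q i * f i := by rw [h1]; ring
          rw [this]
          exact I.sub_mem hg (Ideal.sum_mem _ fun i _ => Ideal.mul_mem_left _ _ (hfI i))
        obtain ⟨d, hd, hmin⟩ := exists_leading_exponent hr0
        have hdL : d ∈ L := by
          refine ⟨(coeff d r)⁻¹ • r, Submodule.smul_of_tower_mem I _ hrI, ?_, fun e he => ?_⟩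
          · rw [map_smul, smul_eq_mul, inv_mul_cancel₀ hd]
          · rw [map_smul, smul_eq_mul] at he
            exact hmin e (right_ne_zero_of_mul he)
        obtain ⟨d', hd', hle⟩ := hS d hdL
        exact hd (h2 ⟨d', hd'⟩ d hle)
      rw [h1, hr, add_zero]
      exact hsum
    · rw [Ideal.span_le]
      rintro _ ⟨d, rfl⟩
      exact hfI d
  rw [hI]
  exact Submodule.fg_span (Set.finite_range f)

end Fintype

end ConvergentSeries

/-! ## Depth of noetherian local rings -/

section Depth

open IsLocalRing

variable {A : Type*} [CommRing A]

/-- Multiplication by `x` is injective on `A ⧸ J`. -/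
def IsRegularMod (J : Ideal A) (x : A) : Prop :=
  ∀ a, x * a ∈ J → a ∈ J

/-- If x a = j + b z, then z b lies in (J, x), so b = j' + c x and x (a - c z) lies in J. No local
hypothesis is needed for this half of the exchange of a regular sequence. -/
theorem IsRegularMod.swap {J : Ideal A} {x z : A} (hx : IsRegularMod J x)
    (hz : IsRegularMod (J ⊔ Ideal.span {x}) z) : IsRegularMod (J ⊔ Ideal.span {z}) x := by
  intro a ha
  obtain ⟨j, hj, y, hy, hjy⟩ := Submodule.mem_sup.1 ha
  obtain ⟨b, rfl⟩ := Ideal.mem_span_singleton'.1 hy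
  have hb : z * b ∈ J ⊔ Ideal.span {x} := by
    have : z * b = -j + x * a := by rw [← hjy]; ring
    rw [this]
    exact Ideal.add_mem _ (Ideal.mem_sup_left (J.neg_mem hj))
      (Ideal.mem_sup_right (Ideal.mem_span_singleton'.2 ⟨a, mul_comm _ _⟩))
  obtain ⟨j', hj', y', hy', hb'⟩ := Submodule.mem_sup.1 (hz b hb)
  obtain ⟨c, rfl⟩ := Ideal.mem_span_singleton'.1 hy'
  have hac : a - c * z ∈ J := hx _ (by
    have : x * (a - c * z) = j + j' * z := by
      rw [mul_sub, ← hjy, ← hb']; ring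
    rw [this]
    exact J.add_mem hj (J.mul_mem_right _ hj'))
  have : a = (a - c * z) + c * z := by ring
  rw [this]
  exact Ideal.add_mem _ (Ideal.mem_sup_left hac)
    (Ideal.mem_sup_right (Ideal.mem_span_singleton'.2 ⟨c, rfl⟩))

theorem exists_notMem_of_mem_associatedPrimes [IsNoetherianRing A] {J Q : Ideal A}
    (hQ : Q ∈ associatedPrimes A (A ⧸ J)) : ∃ a ∉ J, ∀ q, q ∈ Q ↔ q * a ∈ J := by
  obtain ⟨-, y, rfl⟩ := isAssociatedPrime_iff.1 hQ
  obtain ⟨a, rfl⟩ := Ideal.Quotient.mk_surjective y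
  have h : ∀ q, q ∈ Submodule.colon ⊥ {Ideal.Quotient.mk J a} ↔ q * a ∈ J := by
    intro q
    rw [Submodule.mem_colon_singleton, Submodule.mem_bot, Algebra.smul_def,
      Ideal.Quotient.algebraMap_eq, ← map_mul, Ideal.Quotient.eq_zero_iff_mem]
  refine ⟨a, fun ha => hQ.isPrime.ne_top ?_, h⟩
  rw [Ideal.eq_top_iff_one, h]
  simpa using ha

theorem le_of_mem_associatedPrimes [IsNoetherianRing A] {J Q : Ideal A}
    (hQ : Q ∈ associatedPrimes A (A ⧸ J)) : J ≤ Q := by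
  obtain ⟨a, -, h⟩ := exists_notMem_of_mem_associatedPrimes hQ
  exact fun x hx => (h x).2 (J.mul_mem_right _ hx)

theorem exists_le_mem_associatedPrimes [IsNoetherianRing A] {J I : Ideal A} {a : A} (ha : a ∉ J)
    (h : ∀ q ∈ I, q * a ∈ J) : ∃ Q ∈ associatedPrimes A (A ⧸ J), I ≤ Q := by
  obtain ⟨Q, hQ, hle⟩ := exists_le_isAssociatedPrime_of_isNoetherianRing A
    (Ideal.Quotient.mk J a) (by rwa [ne_eq, Ideal.Quotient.eq_zero_iff_mem])
  refine ⟨Q, hQ, fun q hq => hle ?_⟩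
  rw [Submodule.mem_colon_singleton, Submodule.mem_bot, Algebra.smul_def,
      Ideal.Quotient.algebraMap_eq, ← map_mul, Ideal.Quotient.eq_zero_iff_mem]
  exact h q hq

theorem isRegularMod_iff [IsNoetherianRing A] {J : Ideal A} {x : A} :
    IsRegularMod J x ↔ ∀ Q ∈ associatedPrimes A (A ⧸ J), x ∉ Q := by
  constructor
  · intro h Q hQ hx
    obtain ⟨a, ha, h1⟩ := exists_notMem_of_mem_associatedPrimes hQ
    exact ha (h a ((h1 x).1 hx))
  · intro h a ha
    by_contra hna
    obtain ⟨Q, hQ, hle⟩ := exists_le_mem_associatedPrimes (I := Ideal.span {x}) hna (by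
      intro q hq
      obtain ⟨c, rfl⟩ := Ideal.mem_span_singleton'.1 hq
      rw [mul_assoc]
      exact J.mul_mem_left _ ha)
    exact h Q hQ (hle (Ideal.mem_span_singleton_self x))

/-- Prime avoidance. -/
theorem exists_mem_notMem_of_finite {I : Ideal A} {S : Set (Ideal A)} (hS : S.Finite)
    (hp : ∀ Q ∈ S, Q.IsPrime) (h : ∀ Q ∈ S, ¬ I ≤ Q) : ∃ x ∈ I, ∀ Q ∈ S, x ∉ Q := by
  by_contra hcon
  push Not at hcon
  have hsub : (I : Set A) ⊆ ⋃ Q ∈ S, (Q : Set A) := fun x hx => by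
    obtain ⟨Q, hQ, hxQ⟩ := hcon x hx
    exact Set.mem_biUnion hQ hxQ
  obtain ⟨Q, hQ, hle⟩ := (Ideal.subset_union_prime_finite hS (f := id) ⊥ ⊥
    fun Q hQ _ _ => hp Q hQ).1 hsub
  exact h Q hQ hle

variable [IsLocalRing A]

/-- The maximal ideal contains a sequence of length `k` that is regular on `A ⧸ J`. -/
def HasDepth : ℕ → Ideal A → Prop
  | 0, _ => True
  | k + 1, J => ∃ x ∈ maximalIdeal A, IsRegularMod J x ∧ HasDepth k (J ⊔ Ideal.span {x})

variable [IsNoetherianRing A]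

/-- Depth is at most dim A/Q for every associated prime Q. Put N = (J : Q). If N were inside (J, x),
regularity of x would give N ⊆ J + x N, and Nakayama N ⊆ J, which is false. An element of N outside
(J, x) is killed modulo (J, x) by Q + (x), so (J, x) has an associated prime strictly above Q, and
induction applies. -/
theorem HasDepth.le_coheight {k : ℕ} {J Q : Ideal A} (h : HasDepth k J)
    (hQ : Q ∈ associatedPrimes A (A ⧸ J)) :
    (k : ℕ∞) ≤ Order.coheight (⟨Q, hQ.isPrime⟩ : PrimeSpectrum A) := by
  induction k generalizing J Q with
  | zero => simp
  | succ k ih =>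
    obtain ⟨x, hxm, hx, hk⟩ := h
    obtain ⟨a₀, ha₀, hQ0⟩ := exists_notMem_of_mem_associatedPrimes hQ
    let N : Ideal A :=
      { carrier := {a | ∀ q ∈ Q, q * a ∈ J}
        add_mem' := fun ha hb q hq => by rw [mul_add]; exact J.add_mem (ha q hq) (hb q hq)
        zero_mem' := fun q _ => by rw [mul_zero]; exact J.zero_mem
        smul_mem' := fun c a ha q hq => by
          rw [smul_eq_mul, mul_left_comm]; exact J.mul_mem_left _ (ha q hq) }
    have hN : ¬ N ≤ J ⊔ Ideal.span {x} := by
      intro hle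
      have h1 : N ≤ J ⊔ Ideal.span {x} • N := by
        intro a ha
        obtain ⟨j, hj, y, hy, rfl⟩ := Submodule.mem_sup.1 (hle ha)
        obtain ⟨b, rfl⟩ := Ideal.mem_span_singleton'.1 hy
        refine Ideal.add_mem _ (Ideal.mem_sup_left hj) (Ideal.mem_sup_right ?_)
        rw [mul_comm]
        refine Submodule.smul_mem_smul (Ideal.mem_span_singleton_self x) fun q hq => hx _ ?_
        have : x * (q * b) = q * (j + b * x) - q * j := by ring
        rw [this]
        exact J.sub_mem (ha q hq) (J.mul_mem_left _ hj)
      have h2 : N ≤ J := Submodule.le_of_le_smul_of_le_jacobson_bot (IsNoetherian.noetherian N)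
        (by rw [jacobson_eq_maximalIdeal _ bot_ne_top]; simpa using hxm) h1
      exact ha₀ (h2 fun q hq => (hQ0 q).1 hq)
    obtain ⟨a, haN, ha⟩ := Set.not_subset.1 hN
    obtain ⟨Q', hQ', hle⟩ := exists_le_mem_associatedPrimes (I := Q ⊔ Ideal.span {x}) ha (by
      intro q hq
      obtain ⟨q', hq', y, hy, rfl⟩ := Submodule.mem_sup.1 hq
      obtain ⟨b, rfl⟩ := Ideal.mem_span_singleton'.1 hy
      rw [add_mul]
      refine Ideal.add_mem _ (Ideal.mem_sup_left (haN q' hq')) (Ideal.mem_sup_right ?_)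
      exact Ideal.mem_span_singleton'.2 ⟨b * a, by ring⟩)
    have hlt : (⟨Q, hQ.isPrime⟩ : PrimeSpectrum A) < ⟨Q', hQ'.isPrime⟩ := by
      refine lt_of_le_of_ne (le_sup_left.trans hle) fun h => ?_
      rw [PrimeSpectrum.ext_iff] at h
      refine isRegularMod_iff.1 hx Q hQ ?_
      change Q = Q' at h
      rw [h]
      exact hle (Ideal.mem_sup_right (Ideal.mem_span_singleton_self x))
    have h3 := ih hk hQ'
    rw [Nat.cast_add, Nat.cast_one]
    exact (add_le_add_left h3 1).trans (Order.coheight_add_one_le hlt)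

theorem not_maximalIdeal_le_of_isRegularMod {J Q : Ideal A} {z : A} (hz : z ∈ maximalIdeal A)
    (h : IsRegularMod J z) (hQ : Q ∈ associatedPrimes A (A ⧸ J)) : ¬ maximalIdeal A ≤ Q :=
  fun hle => isRegularMod_iff.1 h Q hQ (hle hz)

/-- Any regular element may begin the sequence. Given x from the depth of J, choose z regular modulo
J, (J, x) and (J, y). By induction (J, x, z) has depth k, so (J, z) has depth k + 1 by exchanging x
and z; induction on (J, z) with y then handles (J, z, y). -/
theorem HasDepth.sup_span_singleton {k : ℕ} {J : Ideal A} (h : HasDepth (k + 1) J) {y : A}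
    (hy : IsRegularMod J y) (hym : y ∈ maximalIdeal A) : HasDepth k (J ⊔ Ideal.span {y}) := by
  induction k generalizing J y with
  | zero => trivial
  | succ k ih =>
    obtain ⟨x, hxm, hx, hk⟩ := h
    obtain ⟨x₂, hx₂m, hx₂, -⟩ := id hk
    -- The choice of z needs the maximal ideal not to be associated to (J, y). If it kills u modulo
    -- (J, y), write x u = j + v y. Then v is outside (J, x), although x₂ v lies in (J, x).
    have hJy : ∀ Q ∈ associatedPrimes A (A ⧸ (J ⊔ Ideal.span {y})), ¬ maximalIdeal A ≤ Q := by
      intro Q hQ hle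
      obtain ⟨u, hu, hQu⟩ := exists_notMem_of_mem_associatedPrimes hQ
      have hmu : ∀ i ∈ maximalIdeal A, i * u ∈ J ⊔ Ideal.span {y} := fun i hi =>
        (hQu i).1 (hle hi)
      obtain ⟨j, hj, w, hw, hxu⟩ := Submodule.mem_sup.1 (hmu x hxm)
      obtain ⟨v, rfl⟩ := Ideal.mem_span_singleton'.1 hw
      have hv : v ∉ J ⊔ Ideal.span {x} := by
        intro hv
        obtain ⟨j', hj', w', hw', rfl⟩ := Submodule.mem_sup.1 hv
        obtain ⟨c, rfl⟩ := Ideal.mem_span_singleton'.1 hw'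
        refine hu ?_
        have h1 : u - c * y ∈ J := hx _ (by
          have : x * (u - c * y) = j + j' * y := by rw [mul_sub, ← hxu]; ring
          rw [this]
          exact J.add_mem hj (J.mul_mem_right _ hj'))
        have : u = (u - c * y) + c * y := by ring
        rw [this]
        exact Ideal.add_mem _ (Ideal.mem_sup_left h1)
          (Ideal.mem_sup_right (Ideal.mem_span_singleton'.2 ⟨c, rfl⟩))
      refine hv (hx₂ _ ?_)
      obtain ⟨j'', hj'', w'', hw'', hiu⟩ := Submodule.mem_sup.1 (hmu x₂ hx₂m)
      obtain ⟨c, rfl⟩ := Ideal.mem_span_singleton'.1 hw''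
      have h1 : x₂ * v - c * x ∈ J := hy _ (by
        have : y * (x₂ * v - c * x) = x * j'' - x₂ * j := by
          linear_combination x₂ * hxu - x * hiu
        rw [this]
        exact J.sub_mem (J.mul_mem_left _ hj'') (J.mul_mem_left _ hj))
      have : x₂ * v = (x₂ * v - c * x) + c * x := by ring
      rw [this]
      exact Ideal.add_mem _ (Ideal.mem_sup_left h1)
        (Ideal.mem_sup_right (Ideal.mem_span_singleton'.2 ⟨c, rfl⟩))
    obtain ⟨z, hzm, hz⟩ := exists_mem_notMem_of_finite (I := maximalIdeal A)
      (S := associatedPrimes A (A ⧸ J) ∪ associatedPrimes A (A ⧸ (J ⊔ Ideal.span {x})) ∪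
        associatedPrimes A (A ⧸ (J ⊔ Ideal.span {y})))
      (((associatedPrimes.finite A _).union (associatedPrimes.finite A _)).union
        (associatedPrimes.finite A _))
      (by rintro Q ((hQ | hQ) | hQ) <;> exact hQ.isPrime)
      (by
        rintro Q ((hQ | hQ) | hQ)
        · exact not_maximalIdeal_le_of_isRegularMod hxm hx hQ
        · exact not_maximalIdeal_le_of_isRegularMod hx₂m hx₂ hQ
        · exact hJy Q hQ)
    have hzJ : IsRegularMod J z := isRegularMod_iff.2 fun Q hQ => hz Q (Or.inl (Or.inl hQ))
    have hzx : IsRegularMod (J ⊔ Ideal.span {x}) z :=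
      isRegularMod_iff.2 fun Q hQ => hz Q (Or.inl (Or.inr hQ))
    have hzy : IsRegularMod (J ⊔ Ideal.span {y}) z :=
      isRegularMod_iff.2 fun Q hQ => hz Q (Or.inr hQ)
    have h1 : HasDepth (k + 1) (J ⊔ Ideal.span {z}) :=
      ⟨x, hxm, hx.swap hzx, by rw [sup_right_comm]; exact ih hk hzx hzm⟩
    exact ⟨z, hzm, hzy, by rw [sup_right_comm]; exact ih h1 (hy.swap hzy) hym⟩

/-- In a local ring of depth at least `n` and dimension at most `n`, an ideal of height greater
than `i` contains an element that is regular modulo a given regular sequence of length `i`. -/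
theorem exists_mem_isRegularMod {n : ℕ} {T : Ideal A} (hT : T ≤ maximalIdeal A) {i : ℕ}
    {s : Finset A} (hs : s.card ≤ i) (hTi : ((i + 1 : ℕ) : ℕ∞) ≤ T.height)
    (hdepth : HasDepth (n - i) (Ideal.span (s : Set A)))
    (hdim : ∀ Q : PrimeSpectrum A, Ideal.span (s : Set A) ≤ Q.asIdeal →
      Order.coheight Q + i ≤ n) :
    ∃ t ∈ T, IsRegularMod (Ideal.span (s : Set A)) t ∧
      HasDepth (n - (i + 1)) (Ideal.span (s : Set A) ⊔ Ideal.span {t}) ∧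
      ∀ Q : PrimeSpectrum A, Ideal.span (s : Set A) ⊔ Ideal.span {t} ≤ Q.asIdeal →
        Order.coheight Q + (i + 1 : ℕ) ≤ n := by
  -- Unmixedness: an embedded prime would lie strictly above a prime whose dimension is at most n -
  -- i, against the depth bound.
  have hmin : ∀ Q ∈ associatedPrimes A (A ⧸ Ideal.span (s : Set A)),
      Q ∈ (Ideal.span (s : Set A)).minimalPrimes := by
    intro Q hQ
    refine ⟨⟨hQ.isPrime, le_of_mem_associatedPrimes hQ⟩, fun P hP hPQ => ?_⟩
    by_contra hne
    have hlt : (⟨P, hP.1⟩ : PrimeSpectrum A) < ⟨Q, hQ.isPrime⟩ := lt_of_le_not_ge hPQ hne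
    have h1 := hdepth.le_coheight hQ
    have h2 := Order.coheight_add_one_le hlt
    have h3 := hdim ⟨P, hP.1⟩ hP.2
    have h4 : ((n - i : ℕ) : ℕ∞) + 1 + i ≤ n :=
      (add_le_add_left ((add_le_add_left h1 1).trans h2) _).trans h3
    have h5 : n - i + 1 + i ≤ n := by exact_mod_cast h4
    omega
  -- By Krull's height theorem the associated primes, being minimal over at most i generators, have
  -- height at most i and cannot contain T.
  obtain ⟨t, htT, ht⟩ := exists_mem_notMem_of_finite (I := T)
    (associatedPrimes.finite A (A ⧸ Ideal.span (s : Set A))) (fun Q hQ => hQ.isPrime) (by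
      intro Q hQ hle
      have h1 := Ideal.height_le_card_of_mem_minimalPrimes_span_finset (hmin Q hQ)
      have h2 := hTi.trans ((Ideal.height_mono hle).trans h1)
      have h3 : i + 1 ≤ s.card := by exact_mod_cast h2
      omega)
  have htr : IsRegularMod (Ideal.span (s : Set A)) t := isRegularMod_iff.2 ht
  refine ⟨t, htT, htr, ?_, fun Q hQ => ?_⟩
  · rcases Nat.eq_zero_or_pos (n - i) with h0 | h0
    · have : n - (i + 1) = 0 := by omega
      rw [this]
      trivial
    · have : n - i = n - (i + 1) + 1 := by omega
      rw [this] at hdepth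
      exact hdepth.sup_span_singleton htr (hT htT)
  · obtain ⟨P, hP, hPQ⟩ := Ideal.exists_minimalPrimes_le (le_sup_left.trans hQ)
    have hPass : P ∈ associatedPrimes A (A ⧸ Ideal.span (s : Set A)) := by
      have := Module.associatedPrimes.minimalPrimes_annihilator_subset_associatedPrimes A
        (A ⧸ Ideal.span (s : Set A))
      rw [Ideal.annihilator_quotient] at this
      exact this hP
    have hlt : (⟨P, hP.1.1⟩ : PrimeSpectrum A) < Q := by
      refine lt_of_le_not_ge hPQ fun hge => ht P hPass ?_
      exact hge (hQ (Ideal.mem_sup_right (Ideal.mem_span_singleton_self t)))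
    have h2 := Order.coheight_add_one_le hlt
    have h3 := hdim ⟨P, hP.1.1⟩ hP.1.2
    push_cast
    rw [add_comm (i : ℕ∞) 1, ← add_assoc]
    exact (add_le_add_left h2 _).trans h3

end Depth

/-! ### Depth against dimension: complete intersections are Cohen–Macaulay -/

section CohenMacaulay

open IsLocalRing

variable {A : Type*} [CommRing A]

theorem coheight_eq_ringKrullDim_quotient (Q : PrimeSpectrum A) :
    (Order.coheight Q : WithBot ℕ∞) = ringKrullDim (A ⧸ Q.asIdeal) := by
  rw [ringKrullDim_quotient, Order.coheight_eq_krullDim_Ici]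
  rfl

theorem coheight_le_of_ringKrullDim_quotient_le {I : Ideal A} {n : ℕ}
    (h : ringKrullDim (A ⧸ I) ≤ n) (Q : PrimeSpectrum A) (hQ : I ≤ Q.asIdeal) :
    Order.coheight Q ≤ n := by
  have h1 : ringKrullDim (A ⧸ Q.asIdeal) ≤ ringKrullDim (A ⧸ I) :=
    ringKrullDim_le_of_surjective (Ideal.Quotient.factor hQ) (Ideal.Quotient.factor_surjective hQ)
  rw [← coheight_eq_ringKrullDim_quotient] at h1
  exact_mod_cast h1.trans h

variable [IsLocalRing A]

theorem HasDepth.quotient {k : ℕ} {I : Ideal A} [IsLocalRing (A ⧸ I)] {J : Ideal (A ⧸ I)}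
    (h : HasDepth k (J.comap (Ideal.Quotient.mk I))) : HasDepth k J := by
  induction k generalizing J with
  | zero => trivial
  | succ k ih =>
    obtain ⟨x, hxm, hx, hk⟩ := h
    refine ⟨Ideal.Quotient.mk I x, ?_, ?_, ih ?_⟩
    · have := IsLocalHom.of_surjective (Ideal.Quotient.mk I) Ideal.Quotient.mk_surjective
      exact (mem_maximalIdeal _).2 ((map_mem_nonunits_iff _ x).2 hxm)
    · intro a ha
      obtain ⟨b, rfl⟩ := Ideal.Quotient.mk_surjective a
      exact hx b (by rwa [Ideal.mem_comap, map_mul])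
    · convert! hk using 1
      apply le_antisymm
      · intro a ha
        obtain ⟨j, hj, y, hy, hjy⟩ := Submodule.mem_sup.1 (Ideal.mem_comap.1 ha)
        obtain ⟨c, rfl⟩ := Ideal.mem_span_singleton'.1 hy
        obtain ⟨b, rfl⟩ := Ideal.Quotient.mk_surjective c
        have h1 : a - b * x ∈ J.comap (Ideal.Quotient.mk I) := by
          rw [Ideal.mem_comap, map_sub, ← hjy, map_mul, add_sub_cancel_right]
          exact hj
        have : a = (a - b * x) + b * x := by ring
        rw [this]
        exact Ideal.add_mem _ (Ideal.mem_sup_left h1)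
          (Ideal.mem_sup_right (Ideal.mem_span_singleton'.2 ⟨b, rfl⟩))
      · refine sup_le (Ideal.comap_mono le_sup_left) ?_
        rw [Ideal.span_singleton_le_iff_mem, Ideal.mem_comap]
        exact Ideal.mem_sup_right (Ideal.mem_span_singleton_self _)

variable [IsNoetherianRing A]

/-- Each element of `t` lowers the dimension of A/Q by at most one, and the resulting ring is a
quotient of A/I. -/
theorem ringKrullDim_quotient_le_add_card {I Q : Ideal A} (t : Finset A)
    (ht : (t : Set A) ⊆ maximalIdeal A) (hQ : Q ≠ ⊤) (hI : I ≤ Q ⊔ Ideal.span (t : Set A)) :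
    ringKrullDim (A ⧸ Q) ≤ ringKrullDim (A ⧸ I) + t.card := by
  classical
  have := Ideal.Quotient.nontrivial_iff.2 hQ
  have : IsLocalRing (A ⧸ Q) := .of_surjective' _ Ideal.Quotient.mk_surjective
  let t' : Finset (A ⧸ Q) := t.image (Ideal.Quotient.mk Q)
  have ht' : (t' : Set (A ⧸ Q)) ⊆ Ring.jacobson (A ⧸ Q) := by
    rw [IsLocalRing.ringJacobson_eq_maximalIdeal]
    intro y hy
    obtain ⟨x, hx, rfl⟩ := Finset.mem_image.1 hy
    have := IsLocalHom.of_surjective (Ideal.Quotient.mk Q) Ideal.Quotient.mk_surjective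
    exact (mem_maximalIdeal _).2 ((map_mem_nonunits_iff _ x).2 (ht hx))
  have h1 := ringKrullDim_le_ringKrullDim_quotient_add_card t' ht'
  have h2 : ringKrullDim ((A ⧸ Q) ⧸ Ideal.span (t' : Set (A ⧸ Q))) ≤ ringKrullDim (A ⧸ I) := by
    let φ : A ⧸ I →+* (A ⧸ Q) ⧸ Ideal.span (t' : Set (A ⧸ Q)) :=
      Ideal.Quotient.lift I ((Ideal.Quotient.mk _).comp (Ideal.Quotient.mk Q)) (by
        intro a ha
        obtain ⟨q, hq, y, hy, rfl⟩ := Submodule.mem_sup.1 (hI ha)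
        rw [RingHom.comp_apply, map_add, Ideal.Quotient.eq_zero_iff_mem.2 hq, zero_add,
          Ideal.Quotient.eq_zero_iff_mem]
        have := Ideal.mem_map_of_mem (Ideal.Quotient.mk Q) hy
        rwa [Ideal.map_span, ← Finset.coe_image] at this)
    refine ringKrullDim_le_of_surjective φ (Ideal.Quotient.lift_surjective_of_surjective _ _ ?_)
    exact Ideal.Quotient.mk_surjective.comp Ideal.Quotient.mk_surjective
  refine h1.trans (add_le_add h2 ?_)
  exact_mod_cast Finset.card_image_le

/-- In a local ring of depth at least `N`, elements `f_1, …, f_k` with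
`dim A ⧸ (f_1, …, f_k) ≤ N - k` form a regular sequence. -/
theorem HasDepth.span_range {N k : ℕ} (hA : HasDepth N (⊥ : Ideal A)) (hk : k ≤ N)
    (f : Fin k → A) (hf : ∀ i, f i ∈ maximalIdeal A)
    (hdim : ringKrullDim (A ⧸ Ideal.span (Set.range f)) ≤ (N - k : ℕ)) :
    HasDepth (N - k) (Ideal.span (Set.range f)) := by
  classical
  have key : ∀ i ≤ k, HasDepth (N - i) (Ideal.span (f '' {j | (j : ℕ) < i})) := by
    intro i
    induction i with
    | zero => intro _; simpa using hA
    | succ i ih =>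
      intro hi
      have h := ih (by omega)
      have hset : {j : Fin k | (j : ℕ) < i + 1} = insert ⟨i, hi⟩ {j : Fin k | (j : ℕ) < i} := by
        ext j
        simp only [Set.mem_ofPred_eq, Set.mem_insert_iff, Fin.ext_iff]
        omega
      rw [hset, Set.image_insert_eq, Ideal.span_insert, sup_comm]
      have hNi : N - i = N - (i + 1) + 1 := by omega
      refine HasDepth.sup_span_singleton (by rwa [← hNi]) ?_ (hf _)
      rw [isRegularMod_iff]
      -- If f_i lay in Q, then A/Q, of dimension at least N - i by depth, would be cut to dimension
      -- at most N - k by the remaining k - (i + 1) elements, one too few.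
      intro Q hQ hfQ
      have h1 := h.le_coheight hQ
      have h2 := ringKrullDim_quotient_le_add_card (I := Ideal.span (Set.range f)) (Q := Q)
        ((Finset.univ.filter fun j : Fin k => i < j).image f)
        (by
          intro y hy
          obtain ⟨j, -, rfl⟩ := Finset.mem_image.1 hy
          exact hf j) hQ.isPrime.ne_top (by
          rw [Ideal.span_le]
          rintro _ ⟨j, rfl⟩
          rcases lt_trichotomy (j : ℕ) i with hj | hj | hj
          · exact Ideal.mem_sup_left (le_of_mem_associatedPrimes hQ (Ideal.subset_span ⟨j, hj, rfl⟩))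
          · have : j = ⟨i, hi⟩ := Fin.ext hj
            rw [this]
            exact Ideal.mem_sup_left hfQ
          · exact Ideal.mem_sup_right (Ideal.subset_span (by
              rw [Finset.coe_image]
              exact ⟨j, by simpa using hj, rfl⟩)))
      have hcard : ((Finset.univ.filter fun j : Fin k => i < j).image f).card ≤ k - (i + 1) := by
        refine Finset.card_image_le.trans ?_
        have : (Finset.univ.filter fun j : Fin k => i < j) = Finset.Ioi ⟨i, hi⟩ := by
          ext j; simp [Fin.lt_def]
        rw [this, Fin.card_Ioi]
        simp; omega
      have h3 : ((N - i : ℕ) : WithBot ℕ∞) ≤ ((N - k : ℕ) : WithBot ℕ∞) + (k - (i + 1) : ℕ) := by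
        have h4 : ((N - i : ℕ) : WithBot ℕ∞) ≤ ringKrullDim (A ⧸ Q) := by
          rw [← coheight_eq_ringKrullDim_quotient ⟨Q, hQ.isPrime⟩]
          exact WithBot.coe_le_coe.2 h1
        refine h4.trans (h2.trans (add_le_add hdim ?_))
        exact_mod_cast hcard
      have h5 : N - i ≤ (N - k) + (k - (i + 1)) := by exact_mod_cast h3
      omega
  have h := key k le_rfl
  rwa [show {j : Fin k | (j : ℕ) < k} = Set.univ from Set.eq_univ_of_forall fun j => j.2,
    Set.image_univ] at h

theorem exists_regular_pair {n : ℕ} (hdepth : HasDepth n (⊥ : Ideal A))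
    (hdim : ringKrullDim A ≤ n) {T : Ideal A} (hT : 2 ≤ T.height) :
    ∃ t₁ ∈ T, ∃ t₂ ∈ T, IsRegularMod ⊥ t₁ ∧ IsRegularMod (Ideal.span {t₁}) t₂ ∧
      (3 ≤ T.height → ∃ t₃ ∈ T, IsRegularMod (Ideal.span {t₁} ⊔ Ideal.span {t₂}) t₃) := by
  classical
  by_cases hTtop : T = ⊤
  -- For the unit ideal (smooth L) the sequence 1, 0, 0 serves, since everything is regular modulo
  -- (1).
  · refine ⟨1, by simp [hTtop], 0, T.zero_mem, fun a ha => by simpa using ha, fun a _ => ?_,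
      fun _ => ⟨0, T.zero_mem, fun a _ => ?_⟩⟩ <;> simp
  have hTm : T ≤ maximalIdeal A := le_maximalIdeal hTtop
  have hdim' : ∀ Q : PrimeSpectrum A, Order.coheight Q ≤ n := fun Q => by
    have h := (Order.coheight_le_krullDim Q).trans hdim
    exact_mod_cast h
  obtain ⟨t₁, h₁T, h₁, hd₁, hQ₁⟩ := exists_mem_isRegularMod (n := n) hTm (i := 0) (s := ∅) (by simp)
    (le_trans (by norm_num) hT) (by simpa using hdepth) (fun Q _ => by simpa using hdim' Q)
  simp only [Finset.coe_empty, Ideal.span_empty, bot_sup_eq] at h₁ hd₁ hQ₁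
  obtain ⟨t₂, h₂T, h₂, hd₂, hQ₂⟩ := exists_mem_isRegularMod (n := n) hTm (i := 1) (s := {t₁})
    (by simp) (le_trans (by norm_num) hT) (by simpa using hd₁) (by simpa using hQ₁)
  simp only [Finset.coe_singleton] at h₂ hd₂ hQ₂
  refine ⟨t₁, h₁T, t₂, h₂T, h₁, h₂, fun hT3 => ?_⟩
  have hspan : Ideal.span (({t₁, t₂} : Finset A) : Set A) = Ideal.span {t₁} ⊔ Ideal.span {t₂} := by
    rw [Finset.coe_pair, Ideal.span_insert]
  obtain ⟨t₃, h₃T, h₃, -, -⟩ := exists_mem_isRegularMod (n := n) hTm (i := 2) (s := {t₁, t₂})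
    Finset.card_le_two (le_trans (by norm_num) hT3) (by rw [hspan]; exact hd₂)
    (by rw [hspan]; exact hQ₂)
  exact ⟨t₃, h₃T, by rwa [hspan] at h₃⟩

end CohenMacaulay

namespace ConvergentSeries

/-- The coordinates form a regular sequence; the induction is on the number of coordinates not yet
used. -/
theorem hasDepth_bot {σ : Type*} [Fintype σ] :
    HasDepth (Fintype.card σ) (⊥ : Ideal (ConvergentSeries σ)) := by
  classical
  have key : ∀ (k : ℕ) (s : Finset σ), sᶜ.card = k →
      HasDepth k (Ideal.span (coord '' (s : Set σ))) := by
    intro k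
    induction k with
    | zero => intro _ _; trivial
    | succ k ih =>
      intro s hs
      obtain ⟨i, hi⟩ := Finset.card_pos.1 (by rw [hs]; omega : 0 < sᶜ.card)
      have his : i ∉ s := Finset.mem_compl.1 hi
      refine ⟨coord i, mem_maximalIdeal.2 (eval₀_coord i),
        fun a ha => mem_span_of_coord_mul_mem_span his ha, ?_⟩
      have h := ih (insert i s) (by
        rw [Finset.compl_insert, Finset.card_erase_of_mem hi, hs, Nat.add_sub_cancel])
      rwa [Finset.coe_insert, Set.image_insert_eq, Ideal.span_insert, sup_comm] at h
  simpa using key _ ∅ rfl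

end ConvergentSeries

/-! ## Lagrangian kernels of matrices -/

section LagrangianKernel

open Matrix

variable {n : ℕ} {R : Type*} [CommRing R]

/-- The matrix `δ - E * adj(D_c) * D`, where `D_c` is the minor of `D` on the columns `c`, `δ` is
its determinant and `E` is the inclusion of these columns. It maps to the kernel of `D` and is
multiplication by `δ` on this kernel. -/
def kernelProjector (D : Matrix (Fin n) (Fin n ⊕ Fin n) R) (c : Fin n → Fin n ⊕ Fin n) :
    Matrix (Fin n ⊕ Fin n) (Fin n ⊕ Fin n) R :=
  (D.submatrix id c).det • 1 -
    (1 : Matrix (Fin n ⊕ Fin n) (Fin n ⊕ Fin n) R).submatrix id c *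
      (D.submatrix id c).adjugate * D

theorem mul_one_submatrix (D : Matrix (Fin n) (Fin n ⊕ Fin n) R) (c : Fin n → Fin n ⊕ Fin n) :
    D * (1 : Matrix (Fin n ⊕ Fin n) (Fin n ⊕ Fin n) R).submatrix id c = D.submatrix id c := by
  ext i j
  simp [Matrix.mul_apply, Matrix.one_apply]

theorem mul_kernelProjector (D : Matrix (Fin n) (Fin n ⊕ Fin n) R) (c : Fin n → Fin n ⊕ Fin n) :
    D * kernelProjector D c = 0 := by
  rw [kernelProjector, Matrix.mul_sub, ← Matrix.mul_assoc, ← Matrix.mul_assoc, mul_one_submatrix,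
    Matrix.mul_adjugate]
  simp

theorem kernelProjector_mulVec (D : Matrix (Fin n) (Fin n ⊕ Fin n) R)
    (c : Fin n → Fin n ⊕ Fin n) {v : Fin n ⊕ Fin n → R} (hv : D *ᵥ v = 0) :
    kernelProjector D c *ᵥ v = (D.submatrix id c).det • v := by
  rw [kernelProjector, Matrix.sub_mulVec, ← Matrix.mulVec_mulVec, hv, Matrix.mulVec_zero, sub_zero,
    Matrix.smul_mulVec, Matrix.one_mulVec]

theorem kernelProjector_map {K : Type*} [CommRing K] (φ : R →+* K)
    (D : Matrix (Fin n) (Fin n ⊕ Fin n) R) (c : Fin n → Fin n ⊕ Fin n) :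
    kernelProjector (D.map φ) c = (kernelProjector D c).map φ := by
  have hsub : (D.map φ).submatrix id c = φ.mapMatrix (D.submatrix id c) := rfl
  have hone : ((1 : Matrix (Fin n ⊕ Fin n) (Fin n ⊕ Fin n) K).submatrix id c) =
      ((1 : Matrix (Fin n ⊕ Fin n) (Fin n ⊕ Fin n) R).submatrix id c).map φ := by
    ext i j
    simp [Matrix.one_apply, apply_ite φ]
  change _ = φ.mapMatrix (_ - _)
  rw [map_sub, RingHom.mapMatrix_apply, RingHom.mapMatrix_apply, Matrix.map_mul, Matrix.map_mul,
    kernelProjector, hsub, hone, ← RingHom.map_adjugate, ← RingHom.map_det,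
    RingHom.mapMatrix_apply]
  congr 1
  ext i j
  simp [Matrix.one_apply, apply_ite φ]

theorem J_mulVec_J_mulVec (v : Fin n ⊕ Fin n → R) :
    Matrix.J (Fin n) R *ᵥ (Matrix.J (Fin n) R *ᵥ v) = -v := by
  rw [Matrix.mulVec_mulVec, Matrix.J_squared, Matrix.neg_mulVec, Matrix.one_mulVec]

/-- A vector whose image under `J` is orthogonal to the image of the kernel projector is, up to
the factor `δ`, in the range of `J * Dᵀ`. -/
theorem det_smul_mem_range (D : Matrix (Fin n) (Fin n ⊕ Fin n) R) (c : Fin n → Fin n ⊕ Fin n)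
    {v : Fin n ⊕ Fin n → R}
    (hv : (kernelProjector D c)ᵀ *ᵥ (Matrix.J (Fin n) R *ᵥ v) = 0) :
    (D.submatrix id c).det • v ∈ LinearMap.range (Matrix.J (Fin n) R * Dᵀ).mulVecLin := by
  set S := Matrix.J (Fin n) R
  rw [kernelProjector, Matrix.transpose_sub, Matrix.transpose_smul, Matrix.transpose_one,
    Matrix.transpose_mul, Matrix.sub_mulVec, Matrix.smul_mulVec, Matrix.one_mulVec,
    ← Matrix.mulVec_mulVec, sub_eq_zero] at hv
  -- The hypothesis reads δ J v = Dᵀ (E adj)ᵀ J v. Applying J turns the left side into -δ v, whence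
  -- the sign.
  refine ⟨-(((1 : Matrix (Fin n ⊕ Fin n) (Fin n ⊕ Fin n) R).submatrix id c *
      (D.submatrix id c).adjugate)ᵀ *ᵥ (S *ᵥ v)), ?_⟩
  rw [Matrix.mulVecLin_apply, ← Matrix.mulVec_mulVec, Matrix.mulVec_neg, ← hv, Matrix.mulVec_neg,
    Matrix.mulVec_smul, J_mulVec_J_mulVec, smul_neg, neg_neg]

/-- Isotropy puts ker D inside the range of J Dᵀ. The kernel has dimension at least n and the range
at most n, so they coincide and D kills the range. -/
theorem mul_J_mul_transpose_eq_zero_of_field {K : Type*} [Field K]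
    (D : Matrix (Fin n) (Fin n ⊕ Fin n) K) (c : Fin n → Fin n ⊕ Fin n)
    (hc : (D.submatrix id c).det ≠ 0)
    (hN : (kernelProjector D c)ᵀ * Matrix.J (Fin n) K * kernelProjector D c = 0) :
    D * Matrix.J (Fin n) K * Dᵀ = 0 := by
  set M := Matrix.J (Fin n) K * Dᵀ with hM
  have hle : LinearMap.ker D.mulVecLin ≤ LinearMap.range M.mulVecLin := by
    intro v hv
    rw [LinearMap.mem_ker, Matrix.mulVecLin_apply] at hv
    have h1 : (kernelProjector D c)ᵀ *ᵥ (Matrix.J (Fin n) K *ᵥ v) = 0 := by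
      have h2 := congrArg (· *ᵥ v) hN
      simp only [Matrix.zero_mulVec] at h2
      rw [← Matrix.mulVec_mulVec, kernelProjector_mulVec D c hv, Matrix.mulVec_smul,
        ← Matrix.mulVec_mulVec] at h2
      exact (smul_eq_zero.1 h2).resolve_left hc
    exact (Submodule.smul_mem_iff _ hc).1 (det_smul_mem_range D c h1)
  have hrank : Module.finrank K (LinearMap.range M.mulVecLin) ≤ n := by
    refine (LinearMap.finrank_range_le _).trans ?_
    simp
  have hker : n ≤ Module.finrank K (LinearMap.ker D.mulVecLin) := by
    have h1 := LinearMap.finrank_range_add_finrank_ker D.mulVecLin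
    have h2 := Submodule.finrank_le (LinearMap.range D.mulVecLin)
    simp at h1 h2
    omega
  have heq := Submodule.eq_of_le_of_finrank_le hle (hrank.trans hker)
  rw [Matrix.mul_assoc, ← hM]
  refine Matrix.ext_of_mulVec_single fun j => ?_
  have h1 : M *ᵥ Pi.single j 1 ∈ LinearMap.ker D.mulVecLin := by
    rw [heq]; exact ⟨Pi.single j 1, rfl⟩
  rw [LinearMap.mem_ker, Matrix.mulVecLin_apply, Matrix.mulVec_mulVec] at h1
  rw [h1, Matrix.zero_mulVec]

/-- The ideal of maximal minors. -/
def maximalMinors (D : Matrix (Fin n) (Fin n ⊕ Fin n) R) : Ideal R :=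
  Ideal.span (Set.range fun c : Fin n → Fin n ⊕ Fin n => (D.submatrix id c).det)

theorem maximalMinors_le_iff {D : Matrix (Fin n) (Fin n ⊕ Fin n) R} {T : Ideal R} :
    maximalMinors D ≤ T ↔ ∀ c, (D.submatrix id c).det ∈ T := by
  rw [maximalMinors, Ideal.span_le, Set.range_subset_iff]
  rfl

/-- As R is reduced, it suffices to check in the fraction field of R/P for each minimal prime P.
Kernels need not commute with this base change, so isotropy is carried over by the explicit matrix
`kernelProjector`, which does. -/
theorem mul_J_mul_transpose_eq_zero [IsReduced R] (D : Matrix (Fin n) (Fin n ⊕ Fin n) R)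
    (hD : ∀ P ∈ minimalPrimes R, ¬ maximalMinors D ≤ P)
    (hiso : ∀ v w, D *ᵥ v = 0 → D *ᵥ w = 0 → v ⬝ᵥ (Matrix.J (Fin n) R *ᵥ w) = 0) :
    D * Matrix.J (Fin n) R * Dᵀ = 0 := by
  have hN : ∀ c, (kernelProjector D c)ᵀ * Matrix.J (Fin n) R * kernelProjector D c = 0 := by
    intro c
    refine Matrix.ext_of_mulVec_single fun j => ?_
    rw [Matrix.zero_mulVec]
    funext i
    have hk : ∀ j, D *ᵥ (kernelProjector D c *ᵥ Pi.single j 1) = 0 := fun j => by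
      rw [Matrix.mulVec_mulVec, mul_kernelProjector, Matrix.zero_mulVec]
    have h := hiso _ _ (hk i) (hk j)
    rw [← Matrix.vecMul_transpose, ← Matrix.dotProduct_mulVec, Matrix.mulVec_mulVec,
      Matrix.mulVec_mulVec, single_one_dotProduct] at h
    exact h
  ext i j
  have hmem : (D * Matrix.J (Fin n) R * Dᵀ) i j ∈ nilradical R := by
    rw [nilradical, ← Ideal.sInf_minimalPrimes, Submodule.mem_sInf]
    intro P hP
    have := hP.1.1
    obtain ⟨c, hc⟩ : ∃ c, (D.submatrix id c).det ∉ P := by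
      by_contra hcon
      push Not at hcon
      exact hD P hP (maximalMinors_le_iff.2 hcon)
    let φ : R →+* FractionRing (R ⧸ P) :=
      (algebraMap (R ⧸ P) (FractionRing (R ⧸ P))).comp (Ideal.Quotient.mk P)
    have hφ : ∀ x, φ x = 0 ↔ x ∈ P := fun x => by
      rw [RingHom.comp_apply, map_eq_zero_iff _ (IsFractionRing.injective _ _),
        Ideal.Quotient.eq_zero_iff_mem]
    have hJ : Matrix.J (Fin n) (FractionRing (R ⧸ P)) = (Matrix.J (Fin n) R).map φ := by
      ext i j
      rcases i with i | i <;> rcases j with j | j <;>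
        simp [Matrix.J, Matrix.one_apply, apply_ite φ]
    have h := mul_J_mul_transpose_eq_zero_of_field (D.map φ) c
      (by
        have : (D.map φ).submatrix id c = φ.mapMatrix (D.submatrix id c) := rfl
        rw [this, ← RingHom.map_det, ne_eq, hφ]
        exact hc)
      (by
        rw [kernelProjector_map, hJ, ← Matrix.transpose_map, ← Matrix.map_mul, ← Matrix.map_mul, hN]
        ext; simp)
    rw [hJ, ← Matrix.transpose_map, ← Matrix.map_mul, ← Matrix.map_mul] at h
    rw [← hφ]
    exact congrFun (congrFun h i) j
  rw [nilradical_eq_zero] at hmem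
  exact hmem

variable {D : Matrix (Fin n) (Fin n ⊕ Fin n) R}

/-- Cramer's rule on the columns c. -/
theorem det_smul_eq_zero_of_transpose_mulVec_eq_zero {a : Fin n → R} (ha : Dᵀ *ᵥ a = 0)
    (c : Fin n → Fin n ⊕ Fin n) : (D.submatrix id c).det • a = 0 := by
  have h : (D.submatrix id c)ᵀ *ᵥ a = 0 := by
    funext i
    exact congrFun ha (c i)
  have h2 := congrArg ((D.submatrix id c)ᵀ.adjugate *ᵥ ·) h
  simp only [Matrix.mulVec_zero] at h2
  rwa [Matrix.mulVec_mulVec, Matrix.adjugate_mul, Matrix.det_transpose, Matrix.smul_mulVec,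
    Matrix.one_mulVec] at h2

theorem eq_zero_of_transpose_mulVec_eq_zero {t : R} (ht : t ∈ maximalMinors D)
    (htr : IsRegularMod ⊥ t) {a : Fin n → R} (ha : Dᵀ *ᵥ a = 0) : a = 0 := by
  have hle : maximalMinors D ≤ LinearMap.ker (LinearMap.toSpanSingleton R _ a) :=
    maximalMinors_le_iff.2 fun c => det_smul_eq_zero_of_transpose_mulVec_eq_zero ha c
  have h := hle ht
  rw [LinearMap.mem_ker, LinearMap.toSpanSingleton_apply] at h
  funext i
  exact htr _ (congrFun h i)

theorem eq_zero_of_J_mul_transpose_mulVec_eq_zero {t : R} (ht : t ∈ maximalMinors D)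
    (htr : IsRegularMod ⊥ t) {a : Fin n → R} (ha : (Matrix.J (Fin n) R * Dᵀ) *ᵥ a = 0) :
    a = 0 := by
  refine eq_zero_of_transpose_mulVec_eq_zero ht htr ?_
  rw [← Matrix.mulVec_mulVec] at ha
  have h := congrArg (Matrix.J (Fin n) R *ᵥ ·) ha
  simp only [Matrix.mulVec_zero] at h
  rw [J_mulVec_J_mulVec, neg_eq_zero] at h
  exact h

/-- A vector killed by `t₁ ∈ (t₂)` componentwise: divisibility of vectors along a regular pair. -/
theorem exists_eq_smul_of_smul_eq_smul {ι : Type*} {t₁ t₂ : R}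
    (ht₂ : IsRegularMod (Ideal.span {t₁}) t₂) {a b : ι → R} (h : t₂ • a = t₁ • b) :
    ∃ d : ι → R, a = t₁ • d := by
  have : ∀ i, ∃ d, d * t₁ = a i := fun i => by
    refine Ideal.mem_span_singleton'.1 (ht₂ _ (Ideal.mem_span_singleton'.2 ⟨b i, ?_⟩))
    have := congrFun h i
    simp only [Pi.smul_apply, smul_eq_mul] at this
    rw [this, mul_comm]
  choose d hd using this
  exact ⟨d, funext fun i => by rw [← hd i, Pi.smul_apply, smul_eq_mul, mul_comm]⟩

theorem eq_of_smul_eq_smul {ι : Type*} {t : R} (ht : IsRegularMod ⊥ t) {a b : ι → R}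
    (h : t • a = t • b) : a = b := by
  funext i
  refine sub_eq_zero.1 (ht _ ?_)
  have := congrFun h i
  simp only [Pi.smul_apply, smul_eq_mul] at this
  rw [Submodule.mem_bot, mul_sub, this, sub_self]

/-- With M = J Dᵀ, the minors give t_i v = M a_i. Injectivity of M yields t₂ a₁ = t₁ a₂, the regular
pair yields a₁ = t₁ a, and cancelling t₁ gives M a = v. -/
theorem mem_range_of_mulVec_eq_zero {t₁ t₂ : R} (h₁ : t₁ ∈ maximalMinors D)
    (h₂ : t₂ ∈ maximalMinors D) (hr₁ : IsRegularMod ⊥ t₁)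
    (hr₂ : IsRegularMod (Ideal.span {t₁}) t₂)
    (hiso : ∀ v w, D *ᵥ v = 0 → D *ᵥ w = 0 → v ⬝ᵥ (Matrix.J (Fin n) R *ᵥ w) = 0)
    {v : Fin n ⊕ Fin n → R} (hv : D *ᵥ v = 0) :
    ∃ a, (Matrix.J (Fin n) R * Dᵀ) *ᵥ a = v := by
  have hle : maximalMinors D ≤ Submodule.comap (LinearMap.toSpanSingleton R _ v)
      (LinearMap.range (Matrix.J (Fin n) R * Dᵀ).mulVecLin) := by
    refine maximalMinors_le_iff.2 fun c => det_smul_mem_range D c ?_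
    funext i
    have h := hiso (kernelProjector D c *ᵥ Pi.single i 1) v
      (by rw [Matrix.mulVec_mulVec, mul_kernelProjector, Matrix.zero_mulVec]) hv
    rwa [← Matrix.vecMul_transpose, ← Matrix.dotProduct_mulVec, single_one_dotProduct] at h
  obtain ⟨a₁, ha₁⟩ := hle h₁
  obtain ⟨a₂, ha₂⟩ := hle h₂
  rw [Matrix.mulVecLin_apply, LinearMap.toSpanSingleton_apply] at ha₁ ha₂
  have h : t₂ • a₁ = t₁ • a₂ := by
    refine sub_eq_zero.1 (eq_zero_of_J_mul_transpose_mulVec_eq_zero h₁ hr₁ ?_)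
    rw [Matrix.mulVec_sub, Matrix.mulVec_smul, Matrix.mulVec_smul, ha₁, ha₂, smul_comm, sub_self]
  obtain ⟨a, rfl⟩ := exists_eq_smul_of_smul_eq_smul hr₂ h
  refine ⟨a, eq_of_smul_eq_smul hr₁ ?_⟩
  rw [← Matrix.mulVec_smul, ha₁]

/-- If the maximal minors contain a regular sequence of length three, and the complex
`R ^ n → R ^ 2n → R ^ n` given by `J * Dᵀ` and `D` is exact in the middle, then `D` is
surjective. -/
theorem mulVec_surjective {t₁ t₂ t₃ : R} (h₁ : t₁ ∈ maximalMinors D)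
    (h₂ : t₂ ∈ maximalMinors D) (h₃ : t₃ ∈ maximalMinors D) (hr₁ : IsRegularMod ⊥ t₁)
    (hr₂ : IsRegularMod (Ideal.span {t₁}) t₂)
    (hr₃ : IsRegularMod (Ideal.span {t₁} ⊔ Ideal.span {t₂}) t₃)
    (hker : ∀ v, D *ᵥ v = 0 → ∃ a, (Matrix.J (Fin n) R * Dᵀ) *ᵥ a = v)
    (hzero : D * (Matrix.J (Fin n) R * Dᵀ) = 0) (u : Fin n → R) : ∃ d, D *ᵥ d = u := by
  set M := Matrix.J (Fin n) R * Dᵀ with hM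
  have hle : maximalMinors D ≤ Submodule.comap (LinearMap.toSpanSingleton R _ u)
      (LinearMap.range D.mulVecLin) := by
    refine maximalMinors_le_iff.2 fun c => ?_
    refine ⟨(1 : Matrix (Fin n ⊕ Fin n) (Fin n ⊕ Fin n) R).submatrix id c *ᵥ
      ((D.submatrix id c).adjugate *ᵥ u), ?_⟩
    rw [Matrix.mulVecLin_apply, Matrix.mulVec_mulVec, mul_one_submatrix, Matrix.mulVec_mulVec,
      Matrix.mul_adjugate, Matrix.smul_mulVec, Matrix.one_mulVec, LinearMap.toSpanSingleton_apply]
  obtain ⟨b₁, hb₁⟩ := hle h₁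
  obtain ⟨b₂, hb₂⟩ := hle h₂
  obtain ⟨b₃, hb₃⟩ := hle h₃
  rw [Matrix.mulVecLin_apply, LinearMap.toSpanSingleton_apply] at hb₁ hb₂ hb₃
  -- The local solutions b_i of D b_i = t_i u are compatible up to ker D = im M; the a_ij measure
  -- the discrepancy.
  have hex : ∀ {s t : R} {b b' : Fin n ⊕ Fin n → R}, D *ᵥ b = s • u → D *ᵥ b' = t • u →
      ∃ a, M *ᵥ a = s • b' - t • b := fun {s t b b'} hb hb' => hker _ (by
    rw [Matrix.mulVec_sub, Matrix.mulVec_smul, Matrix.mulVec_smul, hb, hb', smul_comm, sub_self])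
  obtain ⟨a₁₂, h₁₂⟩ := hex hb₁ hb₂
  obtain ⟨a₁₃, h₁₃⟩ := hex hb₁ hb₃
  obtain ⟨a₂₃, h₂₃⟩ := hex hb₂ hb₃
  -- Koszul cocycle relation. It puts t₃ a₁₂ in (t₁, t₂), so by regularity of t₃ the discrepancy a₁₂
  -- is a coboundary t₁ c₂ - t₂ c₁.
  have hcyc : t₁ • a₂₃ - t₂ • a₁₃ + t₃ • a₁₂ = 0 := by
    refine eq_zero_of_J_mul_transpose_mulVec_eq_zero h₁ hr₁ ?_
    rw [← hM, Matrix.mulVec_add, Matrix.mulVec_sub, Matrix.mulVec_smul, Matrix.mulVec_smul,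
      Matrix.mulVec_smul, h₁₂, h₁₃, h₂₃]
    module
  have hc : ∀ i, ∃ c₁ c₂, t₁ * c₂ - t₂ * c₁ = a₁₂ i := fun i => by
    have h := congrFun hcyc i
    simp only [Pi.add_apply, Pi.sub_apply, Pi.smul_apply, smul_eq_mul, Pi.zero_apply] at h
    have hmem : a₁₂ i ∈ Ideal.span {t₁} ⊔ Ideal.span {t₂} := hr₃ _ (by
      have : t₃ * a₁₂ i = (-a₂₃ i) * t₁ + a₁₃ i * t₂ := by linear_combination h
      rw [this]
      exact Ideal.add_mem _ (Ideal.mem_sup_left (Ideal.mem_span_singleton'.2 ⟨_, rfl⟩))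
        (Ideal.mem_sup_right (Ideal.mem_span_singleton'.2 ⟨_, rfl⟩)))
    obtain ⟨y, hy, z, hz, hyz⟩ := Submodule.mem_sup.1 hmem
    obtain ⟨p, rfl⟩ := Ideal.mem_span_singleton'.1 hy
    obtain ⟨q, rfl⟩ := Ideal.mem_span_singleton'.1 hz
    exact ⟨-q, p, by rw [← hyz]; ring⟩
  choose c₁ c₂ hc using hc
  have hc' : a₁₂ = t₁ • c₂ - t₂ • c₁ := funext fun i => (hc i).symm
  -- The corrected solutions agree after cross-multiplication, so the first is divisible by t₁. The
  -- correction is invisible to D because D M = 0.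
  have hdiv : t₂ • (b₁ - M *ᵥ c₁) = t₁ • (b₂ - M *ᵥ c₂) := by
    rw [hc', Matrix.mulVec_sub, Matrix.mulVec_smul, Matrix.mulVec_smul] at h₁₂
    rw [smul_sub, smul_sub]
    linear_combination h₁₂
  obtain ⟨d, hd⟩ := exists_eq_smul_of_smul_eq_smul hr₂ hdiv
  refine ⟨d, eq_of_smul_eq_smul hr₁ ?_⟩
  rw [← Matrix.mulVec_smul, ← hd, Matrix.mulVec_sub, Matrix.mulVec_mulVec, hzero,
    Matrix.zero_mulVec, sub_zero, hb₁]

end LagrangianKernel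

/-! ## Vector fields on a germ -/

theorem Derivation.finset_sum_apply {R A M ι : Type*} [CommSemiring R] [CommSemiring A]
    [AddCommMonoid M] [Algebra R A] [Module A M] [Module R M] (s : Finset ι)
    (d : ι → Derivation R A M) (a : A) : (∑ i ∈ s, d i) a = ∑ i ∈ s, d i a := by
  have h := congrFun (map_sum (Derivation.coeFnAddMonoidHom (R := R) (A := A) (M := M)) d s) a
  rwa [Finset.sum_apply] at h

namespace ConvergentSeries

variable {σ : Type*}

theorem pderiv_coord [DecidableEq σ] (i j : σ) :
    pderiv i (coord j) = if i = j then 1 else 0 := by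
  apply toMvPowerSeries_injective
  refine (MvPowerSeries.pderiv_X i j).trans ?_
  rw [Pi.single_apply]
  by_cases h : i = j
  · rw [if_pos h, if_pos h.symm, map_one]
  · rw [if_neg h, if_neg (Ne.symm h), map_zero]

variable [Fintype σ]

theorem exists_eq_add_sum_mul_coord (g : ConvergentSeries σ) :
    ∃ h : σ → ConvergentSeries σ,
      g = algebraMap ℂ (ConvergentSeries σ) (eval₀ g) + ∑ j, h j * coord j := by
  have hmem : g - algebraMap ℂ _ (eval₀ g) ∈ IsLocalRing.maximalIdeal (ConvergentSeries σ) := by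
    rw [mem_maximalIdeal, map_sub, AlgHom.commutes]
    simp
  rw [maximalIdeal_eq_span, Ideal.mem_span_range_iff_exists_fun] at hmem
  obtain ⟨h, hh⟩ := hmem
  exact ⟨h, by rw [hh]; ring⟩

theorem isLocalRing_quotient {I : Ideal (ConvergentSeries σ)} (hI : I ≠ ⊤) :
    IsLocalRing (ConvergentSeries σ ⧸ I) :=
  have := Ideal.Quotient.nontrivial_iff.2 hI
  .of_surjective' _ Ideal.Quotient.mk_surjective

theorem maximalIdeal_quotient_eq_span {I : Ideal (ConvergentSeries σ)}
    [IsLocalRing (ConvergentSeries σ ⧸ I)] :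
    IsLocalRing.maximalIdeal (ConvergentSeries σ ⧸ I) =
      Ideal.span (Set.range fun j : σ => Ideal.Quotient.mk I (coord j)) := by
  have hloc := IsLocalHom.of_surjective (Ideal.Quotient.mk I) Ideal.Quotient.mk_surjective
  have h : IsLocalRing.maximalIdeal (ConvergentSeries σ ⧸ I) =
      (IsLocalRing.maximalIdeal (ConvergentSeries σ)).map (Ideal.Quotient.mk I) := by
    apply le_antisymm
    · intro x hx
      obtain ⟨y, rfl⟩ := Ideal.Quotient.mk_surjective x
      exact Ideal.mem_map_of_mem _ ((map_mem_nonunits_iff (Ideal.Quotient.mk I) y).1 hx)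
    · rw [Ideal.map_le_iff_le_comap]
      intro y hy
      exact (map_mem_nonunits_iff (Ideal.Quotient.mk I) y).2 hy
  rw [h, maximalIdeal_eq_span, Ideal.map_span, ← Set.range_comp]
  rfl

/-- A derivation with values in `𝒪 ⧸ I` is determined by its values on the coordinates. -/
theorem derivation_eq_zero {I : Ideal (ConvergentSeries σ)}
    (d : Derivation ℂ (ConvergentSeries σ) (ConvergentSeries σ ⧸ I))
    (hd : ∀ j, d (coord j) = 0) : d = 0 := by
  by_cases hI : I = ⊤
  · subst hI
    ext g
    exact Subsingleton.elim _ _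
  have := isLocalRing_quotient hI
  set m := IsLocalRing.maximalIdeal (ConvergentSeries σ ⧸ I)
  -- Writing g = g(0) + ∑ h_j x_j gives d g = ∑ x_j d h_j, which gains one power of m at each turn.
  -- Krull's intersection theorem finishes.
  have hpow : ∀ (k : ℕ) (g : ConvergentSeries σ), d g ∈ m ^ k := by
    intro k
    induction k with
    | zero => intro g; simp
    | succ k ih =>
      intro g
      obtain ⟨h, hg⟩ := exists_eq_add_sum_mul_coord g
      rw [hg, map_add, Derivation.map_algebraMap, zero_add, map_sum]
      refine Ideal.sum_mem _ fun j _ => ?_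
      rw [Derivation.leibniz, hd, smul_zero, zero_add, Algebra.smul_def, pow_succ']
      refine Ideal.mul_mem_mul ?_ (ih _)
      have hm : m = _ := maximalIdeal_quotient_eq_span (I := I)
      rw [hm]
      exact Ideal.subset_span ⟨j, rfl⟩
  ext g
  have hmem : d g ∈ (⨅ k : ℕ, m ^ k) := by
    rw [Submodule.mem_iInf]
    exact fun k => hpow k g
  rw [Ideal.iInf_pow_eq_bot_of_isLocalRing m (IsLocalRing.maximalIdeal.isMaximal _).ne_top] at hmem
  exact hmem

end ConvergentSeries

section TangentModule

open ConvergentSeries Matrix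

variable {n : ℕ} {I : Ideal (SymplecticGerms n)}

/-- The components of a vector field. -/
noncomputable def vectorFieldComponents (I : Ideal (SymplecticGerms n)) :
    TangentModule I →ₗ[SymplecticGerms n ⧸ I] (Fin n ⊕ Fin n → SymplecticGerms n ⧸ I) where
  toFun D j := D (Ideal.Quotient.mk I (coord j))
  map_add' _ _ := rfl
  map_smul' _ _ := rfl

/-- Both sides are derivations of 𝒪 into 𝒪/I with the same values on the coordinates, so
`derivation_eq_zero` applies to their difference. -/
theorem tangentModule_apply_mk (D : TangentModule I) (g : SymplecticGerms n) :
    D (Ideal.Quotient.mk I g) =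
      ∑ j, Ideal.Quotient.mk I (pderiv j g) * vectorFieldComponents I D j := by
  classical
  let d₁ : Derivation ℂ (SymplecticGerms n) (SymplecticGerms n ⧸ I) :=
    D.compAlgebraMap (SymplecticGerms n)
  let d₂ : Derivation ℂ (SymplecticGerms n) (SymplecticGerms n ⧸ I) :=
    ∑ j, (LinearMap.toSpanSingleton (SymplecticGerms n) (SymplecticGerms n ⧸ I)
      (vectorFieldComponents I D j)).compDer (pderiv j)
  have h₂ : ∀ g, d₂ g = ∑ j, Ideal.Quotient.mk I (pderiv j g) * vectorFieldComponents I D j := by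
    intro g
    simp only [d₂, Derivation.finset_sum_apply]
    rfl
  have h := derivation_eq_zero (d₁ - d₂) (fun i => by
    rw [Derivation.sub_apply, h₂, sub_eq_zero]
    simp only [pderiv_coord]
    simp only [apply_ite (Ideal.Quotient.mk I), map_one, map_zero, ite_mul, one_mul, zero_mul,
      Finset.sum_ite_eq', Finset.mem_univ, if_true]
    rfl)
  have h3 := congrArg (fun d => d g) h
  simp only [Derivation.sub_apply, Derivation.zero_apply, sub_eq_zero] at h3
  rw [← h₂, ← h3]
  rfl

theorem vectorFieldComponents_injective : Function.Injective (vectorFieldComponents I) := by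
  intro D D' h
  ext x
  obtain ⟨g, rfl⟩ := Ideal.Quotient.mk_surjective x
  rw [tangentModule_apply_mk, tangentModule_apply_mk, h]

/-- The Jacobian matrix, with entries in the local ring of the germ. -/
noncomputable def jacobianMatrix (I : Ideal (SymplecticGerms n)) (f : Fin n → SymplecticGerms n) :
    Matrix (Fin n) (Fin n ⊕ Fin n) (SymplecticGerms n ⧸ I) :=
  Matrix.of fun i j => Ideal.Quotient.mk I (pderiv j (f i))

theorem jacobianMatrix_mulVec_vectorFieldComponents {f : Fin n → SymplecticGerms n}
    (hf : ∀ i, f i ∈ I) (D : TangentModule I) :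
    jacobianMatrix I f *ᵥ vectorFieldComponents I D = 0 := by
  funext i
  have h := tangentModule_apply_mk D (f i)
  rw [Ideal.Quotient.eq_zero_iff_mem.2 (hf i), map_zero] at h
  exact h.symm

/-- Lift v to a vector field on ℂ²ⁿ. The equation D v = 0 says that the lift maps the generators
into I, so it preserves I and descends. -/
theorem exists_vectorFieldComponents_eq {f : Fin n → SymplecticGerms n}
    (hf : Ideal.span (Set.range f) = I) {v : Fin n ⊕ Fin n → SymplecticGerms n ⧸ I}
    (hv : jacobianMatrix I f *ᵥ v = 0) : ∃ D, vectorFieldComponents I D = v := by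
  classical
  choose w hw using fun j => Ideal.Quotient.mk_surjective (v j)
  let d : Derivation ℂ (SymplecticGerms n) (SymplecticGerms n) := ∑ j, w j • pderiv j
  have hd : ∀ g, d g = ∑ j, w j * pderiv j g := fun g => by
    simp only [d, Derivation.finset_sum_apply]
    rfl
  have hdf : ∀ i, d (f i) ∈ I := fun i => by
    rw [← Ideal.Quotient.eq_zero_iff_mem, hd, map_sum]
    refine Eq.trans ?_ (congrFun hv i)
    refine Finset.sum_congr rfl fun j _ => ?_
    rw [map_mul, hw, mul_comm]
    rfl
  have hdI : ∀ g, Ideal.Quotient.mkₐ ℂ I g = 0 → Ideal.Quotient.mkₐ ℂ I (d g) = 0 := by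
    intro g hg
    rw [Ideal.Quotient.mkₐ_eq_mk, Ideal.Quotient.eq_zero_iff_mem] at *
    rw [← hf, Ideal.mem_span_range_iff_exists_fun] at hg
    obtain ⟨c, rfl⟩ := hg
    rw [map_sum]
    refine Ideal.sum_mem _ fun i _ => ?_
    rw [Derivation.leibniz, smul_eq_mul, smul_eq_mul]
    refine Ideal.add_mem _ (I.mul_mem_left _ (hdf i)) (I.mul_mem_right _ ?_)
    rw [← hf]
    exact Ideal.subset_span ⟨i, rfl⟩
  refine ⟨Derivation.liftOfSurjective (Ideal.Quotient.mkₐ_surjective ℂ I) hdI, ?_⟩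
  funext j
  refine (Derivation.liftOfSurjective_apply (Ideal.Quotient.mkₐ_surjective ℂ I) hdI
    (coord j)).trans ?_
  rw [hd]
  simp [pderiv_coord, hw]

theorem J_mulVec_inl {R : Type*} [CommRing R] (w : Fin n ⊕ Fin n → R) (i : Fin n) :
    (Matrix.J (Fin n) R *ᵥ w) (Sum.inl i) = -w (Sum.inr i) := by
  rw [Matrix.J, Matrix.fromBlocks_mulVec]
  simp [Matrix.neg_mulVec]

theorem J_mulVec_inr {R : Type*} [CommRing R] (w : Fin n ⊕ Fin n → R) (i : Fin n) :
    (Matrix.J (Fin n) R *ᵥ w) (Sum.inr i) = w (Sum.inl i) := by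
  rw [Matrix.J, Matrix.fromBlocks_mulVec]
  simp

/-- The sign arises because `Matrix.J` has its block -1 in the upper right corner. -/
theorem symplecticPairing_eq (D D' : TangentModule I) :
    symplecticPairing I D D' =
      -(vectorFieldComponents I D ⬝ᵥ
        (Matrix.J (Fin n) (SymplecticGerms n ⧸ I) *ᵥ vectorFieldComponents I D')) := by
  rw [symplecticPairing, dotProduct, Fintype.sum_sum_type, ← Finset.sum_add_distrib,
    ← Finset.sum_neg_distrib]
  refine Finset.sum_congr rfl fun i _ => ?_
  rw [J_mulVec_inl, J_mulVec_inr]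
  simp only [vectorFieldComponents, LinearMap.coe_mk, AddHom.coe_mk]
  ring

theorem dotProduct_J_mulVec_eq_zero {f : Fin n → SymplecticGerms n}
    (hf : Ideal.span (Set.range f) = I)
    (hiso : ∀ D D' : TangentModule I, symplecticPairing I D D' = 0)
    (v w : Fin n ⊕ Fin n → SymplecticGerms n ⧸ I) (hv : jacobianMatrix I f *ᵥ v = 0)
    (hw : jacobianMatrix I f *ᵥ w = 0) :
    v ⬝ᵥ (Matrix.J (Fin n) (SymplecticGerms n ⧸ I) *ᵥ w) = 0 := by
  obtain ⟨D, rfl⟩ := exists_vectorFieldComponents_eq hf hv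
  obtain ⟨D', rfl⟩ := exists_vectorFieldComponents_eq hf hw
  rw [← neg_eq_zero, ← symplecticPairing_eq, hiso]

/-- By Leibniz, the Jacobian of any n elements of I is, modulo I, a square coefficient matrix times
that of the generators. This carries lower bounds on the codimension over to the minors. -/
theorem singularLocusIdeal_le_maximalMinors {f : Fin n → SymplecticGerms n}
    (hf : Ideal.span (Set.range f) = I) :
    singularLocusIdeal I ≤ maximalMinors (jacobianMatrix I f) := by
  rw [singularLocusIdeal, Ideal.span_le]
  rintro _ ⟨g, c, rfl⟩
  have hg : ∀ i, ∃ b : Fin n → SymplecticGerms n, ∑ k, b k * f k = (g i).1 := fun i => by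
    rw [← Ideal.mem_span_range_iff_exists_fun, hf]
    exact (g i).2
  choose b hb using hg
  have hfI : ∀ k, f k ∈ I := fun k => hf ▸ Ideal.subset_span ⟨k, rfl⟩
  have hmat : (Ideal.Quotient.mk I).mapMatrix
      (Matrix.of fun i j => pderiv (c j) (g i).1) =
      (Matrix.of fun i k => Ideal.Quotient.mk I (b i k)) *
        (jacobianMatrix I f).submatrix id c := by
    ext i j
    rw [RingHom.mapMatrix_apply, Matrix.map_apply, Matrix.of_apply, ← hb, map_sum, map_sum,
      Matrix.mul_apply]
    refine Finset.sum_congr rfl fun k _ => ?_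
    rw [Derivation.leibniz, smul_eq_mul, smul_eq_mul, map_add, map_mul, map_mul,
      Ideal.Quotient.eq_zero_iff_mem.2 (hfI k), zero_mul, add_zero]
    rfl
  rw [SetLike.mem_coe, RingHom.map_det, hmat, Matrix.det_mul]
  exact Ideal.mul_mem_left _ _ (Ideal.subset_span ⟨c, rfl⟩)

theorem pderiv_mem_of_mem_sq {g : SymplecticGerms n} (hg : g ∈ I ^ 2) (j : Fin n ⊕ Fin n) :
    pderiv j g ∈ I := by
  rw [pow_two] at hg
  refine Submodule.mul_induction_on hg (fun a ha b hb => ?_) fun a b ha hb => ?_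
  · rw [Derivation.leibniz, smul_eq_mul, smul_eq_mul]
    exact I.add_mem (I.mul_mem_right _ ha) (I.mul_mem_right _ hb)
  · rw [map_add]
    exact I.add_mem ha hb

/-- The components of the vector field `{∑ b_i f_i, ·}` on the germ. -/
theorem J_mul_transpose_jacobianMatrix_mulVec {f : Fin n → SymplecticGerms n} (hf : ∀ i, f i ∈ I)
    (b : Fin n → SymplecticGerms n) :
    (Matrix.J (Fin n) (SymplecticGerms n ⧸ I) * (jacobianMatrix I f)ᵀ) *ᵥ
        (fun i => Ideal.Quotient.mk I (b i)) =
      Matrix.J (Fin n) (SymplecticGerms n ⧸ I) *ᵥ fun j =>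
        Ideal.Quotient.mk I (pderiv j (∑ i, b i * f i)) := by
  rw [← Matrix.mulVec_mulVec]
  congr 1
  funext j
  refine Eq.trans ?_ (congrArg (Ideal.Quotient.mk I)
    (map_sum (pderiv j) (fun i => b i * f i) Finset.univ)).symm
  rw [map_sum, Matrix.mulVec, dotProduct]
  refine Finset.sum_congr rfl fun i _ => ?_
  rw [Derivation.leibniz, smul_eq_mul, smul_eq_mul, map_add, map_mul, map_mul,
    Ideal.Quotient.eq_zero_iff_mem.2 (hf i), zero_mul, add_zero, mul_comm]
  rfl

/-- The field {f, ·} has components J ∇f in these sign conventions. -/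
theorem mk_poissonBracket (f g : SymplecticGerms n) :
    Ideal.Quotient.mk I (poissonBracket f g) =
      ∑ j, Ideal.Quotient.mk I (pderiv j g) *
        (Matrix.J (Fin n) (SymplecticGerms n ⧸ I) *ᵥ fun j => Ideal.Quotient.mk I (pderiv j f)) j := by
  rw [poissonBracket, map_sum, Fintype.sum_sum_type, ← Finset.sum_add_distrib]
  refine Finset.sum_congr rfl fun i _ => ?_
  rw [J_mulVec_inl, J_mulVec_inr, map_sub, map_mul, map_mul]
  ring

end TangentModule

/-! ### The conormal module and hamiltonian vector fields -/

section ConormalModule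

open ConvergentSeries Matrix

variable {n : ℕ} {I : Ideal (SymplecticGerms n)}

/-- Both modules embed in R²ⁿ with the same image, ker D. -/
theorem exists_linearEquiv_tangentModule {f : Fin n → SymplecticGerms n}
    (hf : Ideal.span (Set.range f) = I)
    (hzero : jacobianMatrix I f *
      (Matrix.J (Fin n) (SymplecticGerms n ⧸ I) * (jacobianMatrix I f)ᵀ) = 0)
    (hinj : ∀ a, (Matrix.J (Fin n) (SymplecticGerms n ⧸ I) * (jacobianMatrix I f)ᵀ) *ᵥ a = 0 →
      a = 0)
    (hker : ∀ v, jacobianMatrix I f *ᵥ v = 0 →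
      ∃ a, (Matrix.J (Fin n) (SymplecticGerms n ⧸ I) * (jacobianMatrix I f)ᵀ) *ᵥ a = v) :
    ∃ μ : (Fin n → SymplecticGerms n ⧸ I) ≃ₗ[SymplecticGerms n ⧸ I] TangentModule I,
      ∀ a, vectorFieldComponents I (μ a) =
        (Matrix.J (Fin n) (SymplecticGerms n ⧸ I) * (jacobianMatrix I f)ᵀ) *ᵥ a := by
  set M := Matrix.J (Fin n) (SymplecticGerms n ⧸ I) * (jacobianMatrix I f)ᵀ
  have hMinj : Function.Injective M.mulVecLin :=
    (injective_iff_map_eq_zero M.mulVecLin).2 hinj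
  have hrange : LinearMap.range M.mulVecLin = LinearMap.range (vectorFieldComponents I) := by
    apply le_antisymm
    · rintro _ ⟨a, rfl⟩
      exact exists_vectorFieldComponents_eq hf (by
        rw [Matrix.mulVecLin_apply, Matrix.mulVec_mulVec, hzero, Matrix.zero_mulVec])
    · rintro _ ⟨D, rfl⟩
      exact hker _ (jacobianMatrix_mulVec_vectorFieldComponents
        (fun i => hf ▸ Ideal.subset_span ⟨i, rfl⟩) D)
  let ν := LinearEquiv.ofInjective (vectorFieldComponents I) vectorFieldComponents_injective
  let μ := (LinearEquiv.ofInjective M.mulVecLin hMinj).trans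
    ((LinearEquiv.ofEq _ _ hrange).trans ν.symm)
  refine ⟨μ, fun a => ?_⟩
  have h : ν (μ a) = LinearEquiv.ofEq _ _ hrange (LinearEquiv.ofInjective M.mulVecLin hMinj a) :=
    ν.apply_symm_apply _
  exact congrArg Subtype.val h

/-- If ∑ b_i f_i lies in I², its partial derivatives lie in I. Modulo I these are the entries of Dᵀ
b, so injectivity of Dᵀ puts every b_i in I: the classes of the f_i form a basis. -/
theorem exists_linearEquiv_cotangent {f : Fin n → SymplecticGerms n}
    (hf : Ideal.span (Set.range f) = I)
    (hinj : ∀ a, (jacobianMatrix I f)ᵀ *ᵥ a = 0 → a = 0) :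
    ∃ ψ : (Fin n → SymplecticGerms n ⧸ I) ≃ₗ[SymplecticGerms n ⧸ I] I.Cotangent,
      ∀ (b : Fin n → SymplecticGerms n) (h : ∑ i, b i * f i ∈ I),
        ψ (fun i => Ideal.Quotient.mk I (b i)) = I.toCotangent ⟨∑ i, b i * f i, h⟩ := by
  have hfI : ∀ i, f i ∈ I := fun i => hf ▸ Ideal.subset_span ⟨i, rfl⟩
  let ψ := Fintype.linearCombination (SymplecticGerms n ⧸ I)
    (fun i => I.toCotangent ⟨f i, hfI i⟩)
  have hψ : ∀ (b : Fin n → SymplecticGerms n) (h : ∑ i, b i * f i ∈ I),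
        ψ (fun i => Ideal.Quotient.mk I (b i)) = I.toCotangent ⟨∑ i, b i * f i, h⟩ := by
    intro b h
    have h1 : (⟨∑ i, b i * f i, h⟩ : I) = ∑ i, b i • (⟨f i, hfI i⟩ : I) :=
      Subtype.ext (by simp)
    rw [h1, map_sum]
    simp only [ψ, Fintype.linearCombination_apply, map_smul]
    refine Finset.sum_congr rfl fun i _ => ?_
    rw [← Ideal.Quotient.algebraMap_eq, algebraMap_smul]
  have hbij : Function.Bijective ψ := by
    constructor
    · refine (injective_iff_map_eq_zero ψ).2 fun a ha => hinj a ?_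
      choose b hb using fun i => Ideal.Quotient.mk_surjective (a i)
      have hab : a = fun i => Ideal.Quotient.mk I (b i) := funext fun i => (hb i).symm
      have hmem : ∑ i, b i * f i ∈ I := Ideal.sum_mem _ fun i _ => I.mul_mem_left _ (hfI i)
      rw [hab, hψ b hmem, Ideal.toCotangent_eq_zero] at ha
      have h := J_mul_transpose_jacobianMatrix_mulVec hfI b
      have h0 : (fun j => Ideal.Quotient.mk I (pderiv j (∑ i, b i * f i))) = 0 :=
        funext fun j => Ideal.Quotient.eq_zero_iff_mem.2 (pderiv_mem_of_mem_sq ha j)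
      rw [h0, Matrix.mulVec_zero, ← Matrix.mulVec_mulVec, ← hab] at h
      have h2 := congrArg (Matrix.J (Fin n) (SymplecticGerms n ⧸ I) *ᵥ ·) h
      simp only [Matrix.mulVec_zero] at h2
      rwa [J_mulVec_J_mulVec, neg_eq_zero] at h2
    · intro y
      obtain ⟨⟨g, hg⟩, rfl⟩ := I.toCotangent_surjective y
      obtain ⟨b, rfl⟩ := Ideal.mem_span_range_iff_exists_fun.1 (hf.symm ▸ hg)
      exact ⟨_, hψ b hg⟩
  exact ⟨LinearEquiv.ofBijective ψ hbij, hψ⟩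

theorem exists_cotangent_linearEquiv_tangentModule {f : Fin n → SymplecticGerms n}
    (hf : Ideal.span (Set.range f) = I)
    (μ : (Fin n → SymplecticGerms n ⧸ I) ≃ₗ[SymplecticGerms n ⧸ I] TangentModule I)
    (hμ : ∀ a, vectorFieldComponents I (μ a) =
        (Matrix.J (Fin n) (SymplecticGerms n ⧸ I) * (jacobianMatrix I f)ᵀ) *ᵥ a)
    (hinj : ∀ a, (jacobianMatrix I f)ᵀ *ᵥ a = 0 → a = 0) :
    ∃ e : I.Cotangent ≃ₗ[SymplecticGerms n ⧸ I] TangentModule I,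
      ∀ (f : I) (g : SymplecticGerms n),
        e (I.toCotangent f) (Ideal.Quotient.mk I g) =
          Ideal.Quotient.mk I (poissonBracket f.1 g) := by
  obtain ⟨ψ, hψ⟩ := exists_linearEquiv_cotangent hf hinj
  refine ⟨ψ.symm.trans μ, fun ⟨F, hF⟩ g => ?_⟩
  obtain ⟨b, rfl⟩ := Ideal.mem_span_range_iff_exists_fun.1 (hf.symm ▸ hF)
  rw [← hψ b hF, LinearEquiv.trans_apply, LinearEquiv.symm_apply_apply, tangentModule_apply_mk, hμ,
    J_mul_transpose_jacobianMatrix_mulVec (fun i => hf ▸ Ideal.subset_span ⟨i, rfl⟩),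
    mk_poissonBracket]

end ConormalModule

/-! ## Regularity from the cotangent space -/

section LinearAlgebra

open Matrix Polynomial

theorem comp_aeval_eq_aeval_comp {K M N : Type*} [CommRing K] [AddCommGroup M] [Module K M]
    [AddCommGroup N] [Module K N] (g : M →ₗ[K] N) (a : Module.End K M) (b : Module.End K N)
    (h : ∀ x, g (a x) = b (g x)) (p : K[X]) (x : M) : g (aeval a p x) = aeval b p (g x) := by
  induction p using Polynomial.induction_on generalizing x with
  | C r => simp
  | add p q hp hq => simp [hp, hq]
  | monomial k r hk =>
    have e : (C r * X ^ (k + 1) : K[X]) = C r * X ^ k * X := by ring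
    rw [e, map_mul (aeval a), map_mul (aeval b), aeval_X, aeval_X, Module.End.mul_apply,
      Module.End.mul_apply, hk, h]

theorem dotProduct_aeval_transpose {K ι : Type*} [CommRing K] [Fintype ι] (B : Matrix ι ι K)
    (p : K[X]) (v w : ι → K) :
    v ⬝ᵥ aeval Bᵀ.mulVecLin p w = aeval B.mulVecLin p v ⬝ᵥ w := by
  induction p using Polynomial.induction_on generalizing w v with
  | C r => simp
  | add p q hp hq =>
    rw [map_add, map_add, LinearMap.add_apply, LinearMap.add_apply, dotProduct_add,
      add_dotProduct, hp, hq]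
  | monomial k r hk =>
    have e : (C r * X ^ (k + 1) : K[X]) = C r * X ^ k * X := by ring
    have e' : (C r * X ^ (k + 1) : K[X]) = X * (C r * X ^ k) := by ring
    nth_rewrite 1 [e']
    rw [e, map_mul (aeval Bᵀ.mulVecLin), map_mul (aeval B.mulVecLin), aeval_X, aeval_X,
      Module.End.mul_apply, Module.End.mul_apply, ← hk, Matrix.mulVecLin_apply,
      Matrix.mulVecLin_apply, Matrix.dotProduct_mulVec, Matrix.vecMul_transpose]

theorem aeval_apply_of_apply_eq_smul {K M : Type*} [Field K] [AddCommGroup M] [Module K M]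
    {a : Module.End K M} {x : M} {r : K} (h : a x = r • x) (p : K[X]) :
    aeval a p x = p.eval r • x := by
  by_cases hx : x = 0
  · simp [hx]
  · exact Module.End.aeval_apply_of_hasEigenvector
      ⟨Module.End.mem_eigenspace_iff.2 h, hx⟩

/-- A hamiltonian matrix that preserves a subspace `W`, and has a positive set of eigenvectors
spanning the quotient by `W`, can only do so if `W` is at least half-dimensional. -/
theorem le_finrank_of_hamiltonian {n : ℕ} {H : Matrix (Fin n ⊕ Fin n) (Fin n ⊕ Fin n) ℂ}
    (hH : Hᵀ = H) {W : Submodule ℂ (Fin n ⊕ Fin n → ℂ)}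
    (hW : ∀ c ∈ W, (Matrix.J (Fin n) ℂ * H)ᵀ *ᵥ c ∈ W) {k : ℕ} (c : Fin k → Fin n ⊕ Fin n → ℂ)
    (w : Fin k → ℕ) (hw : ∀ i, 0 < w i)
    (hc : ∀ i, (Matrix.J (Fin n) ℂ * H)ᵀ *ᵥ c i - (w i : ℂ) • c i ∈ W)
    (hspan : W ⊔ Submodule.span ℂ (Set.range c) = ⊤) : n ≤ Module.finrank ℂ W := by
  set S := Matrix.J (Fin n) ℂ with hS
  set a : Module.End ℂ (Fin n ⊕ Fin n → ℂ) := (S * H)ᵀ.mulVecLin with ha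
  set b : Module.End ℂ (Fin n ⊕ Fin n → ℂ) := (S * H).mulVecLin with hb
  let q : Module.End ℂ ((Fin n ⊕ Fin n → ℂ) ⧸ W) := W.mapQ W a hW
  -- The polynomial p kills the operator q induced on the quotient by W, while p(-q) is invertible:
  -- its values at the -w_j are nonzero because all weights are positive.
  let p : ℂ[X] := ∏ i, (X - C (w i : ℂ))
  have hqc : ∀ i, q (W.mkQ (c i)) = (w i : ℂ) • W.mkQ (c i) := fun i => by
    rw [← map_smul]
    exact (Submodule.Quotient.eq W).2 (hc i)
  have hspan' : Submodule.span ℂ (Set.range fun i => W.mkQ (c i)) = ⊤ := by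
    have h := congrArg (Submodule.map W.mkQ) hspan
    rw [Submodule.map_sup, Submodule.map_top, Submodule.range_mkQ, Submodule.map_span,
      ← Set.range_comp, Submodule.mkQ_map_self, bot_sup_eq] at h
    exact h
  have hpq : aeval q p = 0 := by
    refine LinearMap.ext_on_range hspan' fun i => ?_
    rw [aeval_apply_of_apply_eq_smul (hqc i), LinearMap.zero_apply, eval_prod,
      Finset.prod_eq_zero (Finset.mem_univ i) (by simp), zero_smul]
  have hpa : ∀ x, aeval a p x ∈ W := fun x => by
    rw [← Submodule.Quotient.mk_eq_zero, ← Submodule.mkQ_apply,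
      comp_aeval_eq_aeval_comp W.mkQ a q (fun _ => rfl) p x, hpq, LinearMap.zero_apply]
  have hneg : Function.Injective (aeval (-q) p) := by
    rw [LinearMap.injective_iff_surjective, ← LinearMap.range_eq_top, eq_top_iff, ← hspan',
      Submodule.span_le]
    rintro _ ⟨i, rfl⟩
    have h1 : (-q) (W.mkQ (c i)) = (-(w i : ℂ)) • W.mkQ (c i) := by
      rw [LinearMap.neg_apply, hqc, neg_smul]
    have h2 : p.eval (-(w i : ℂ)) ≠ 0 := by
      rw [eval_prod]
      refine Finset.prod_ne_zero_iff.2 fun j _ => ?_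
      have : ((w i + w j : ℕ) : ℂ) ≠ 0 := Nat.cast_ne_zero.2 (by have := hw i; omega)
      intro h
      apply this
      push_cast
      simp only [eval_sub, eval_X, eval_C] at h
      linear_combination -h
    refine ⟨(p.eval (-(w i : ℂ)))⁻¹ • W.mkQ (c i), ?_⟩
    rw [map_smul, aeval_apply_of_apply_eq_smul h1, smul_smul, inv_mul_cancel₀ h2, one_smul]
  -- The annihilator of W under the dot product, of dimension at least 2n - dim W. Since J embeds it
  -- in W, the claim follows.
  let T : Submodule ℂ (Fin n ⊕ Fin n → ℂ) :=
    LinearMap.ker (W.dualRestrict ∘ₗ (dotProductEquiv ℂ (Fin n ⊕ Fin n)).toLinearMap)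
  have hT : ∀ τ ∈ T, ∀ x ∈ W, τ ⬝ᵥ x = 0 := fun τ hτ x hx =>
    LinearMap.congr_fun (LinearMap.mem_ker.1 hτ) ⟨x, hx⟩
  -- Since p(a) maps into W, its transpose p(b) kills τ. As H is symmetric, S b = -a S, so p(-a)
  -- kills S τ; in the quotient p(-q) is injective, so the class of S τ is zero.
  have hST : ∀ τ ∈ T, S *ᵥ τ ∈ W := by
    intro τ hτ
    have h1 : aeval b p τ = 0 := by
      refine (dotProductEquiv ℂ (Fin n ⊕ Fin n)).injective (LinearMap.ext fun x => ?_)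
      rw [map_zero, LinearMap.zero_apply]
      change aeval b p τ ⬝ᵥ x = 0
      rw [hb, ← dotProduct_aeval_transpose]
      exact hT τ hτ _ (hpa x)
    have h2 : aeval (-a) p (S *ᵥ τ) = 0 := by
      have h3 := comp_aeval_eq_aeval_comp S.mulVecLin b (-a) (fun x => by
        rw [ha, hb, LinearMap.neg_apply]
        simp only [Matrix.mulVecLin_apply, Matrix.mulVec_mulVec]
        rw [Matrix.transpose_mul, hH, hS, Matrix.J_transpose, Matrix.mul_neg, Matrix.neg_mul,
          Matrix.neg_mulVec, neg_neg, ← Matrix.mul_assoc, Matrix.mul_assoc H, Matrix.J_squared]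
        simp) p τ
      rw [h1, map_zero] at h3
      exact h3.symm
    have h4 : aeval (-q) p (W.mkQ (S *ᵥ τ)) = 0 := by
      rw [← comp_aeval_eq_aeval_comp W.mkQ (-a) (-q) (fun x => ?_) p, h2, map_zero]
      rw [LinearMap.neg_apply, LinearMap.neg_apply, map_neg]
      rfl
    have h5 := hneg (h4.trans (map_zero _).symm)
    rwa [Submodule.mkQ_apply, Submodule.Quotient.mk_eq_zero] at h5
  have h1 : Module.finrank ℂ T ≤ Module.finrank ℂ W := by
    refine LinearMap.finrank_le_finrank_of_injective
      (f := (S.mulVecLin.restrict hST : T →ₗ[ℂ] W)) fun x y hxy => Subtype.ext ?_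
    have h2 : S *ᵥ (x : Fin n ⊕ Fin n → ℂ) = S *ᵥ y := congrArg Subtype.val hxy
    have h3 := congrArg (S *ᵥ ·) h2
    simp only [hS, J_mulVec_J_mulVec] at h3
    exact neg_injective h3
  have h2 := LinearMap.finrank_range_add_finrank_ker
    (W.dualRestrict ∘ₗ (dotProductEquiv ℂ (Fin n ⊕ Fin n)).toLinearMap)
  have h3 := Submodule.finrank_le (LinearMap.range
    (W.dualRestrict ∘ₗ (dotProductEquiv ℂ (Fin n ⊕ Fin n)).toLinearMap))
  rw [Subspace.dual_finrank_eq] at h3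
  rw [Module.finrank_fintype_fun_eq_card, Fintype.card_sum, Fintype.card_fin] at h2
  change _ + Module.finrank ℂ T = _ at h2
  omega

end LinearAlgebra

/-! ### Linear forms and the embedding dimension of the germ -/

section Regular

open ConvergentSeries Matrix IsLocalRing

variable {n : ℕ} {I : Ideal (SymplecticGerms n)}

/-- The linear form with coefficients `c`, as a function on the germ. -/
noncomputable def linearFormGerm (I : Ideal (SymplecticGerms n)) :
    (Fin n ⊕ Fin n → ℂ) →ₗ[ℂ] SymplecticGerms n ⧸ I :=
  Fintype.linearCombination ℂ fun j => Ideal.Quotient.mk I (coord j)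

theorem linearFormGerm_apply (c : Fin n ⊕ Fin n → ℂ) :
    linearFormGerm I c = ∑ j, c j • Ideal.Quotient.mk I (coord j) :=
  Fintype.linearCombination_apply ..

theorem linearFormGerm_single (j : Fin n ⊕ Fin n) :
    linearFormGerm I (Pi.single j 1) = Ideal.Quotient.mk I (coord j) := by
  rw [linearFormGerm, Fintype.linearCombination_apply_single, one_smul]

/-- The first-order Taylor expansion of a germ. -/
theorem sub_linear_mem_maximalIdeal_sq {g : SymplecticGerms n} (hg : eval₀ g = 0) :
    g - ∑ j, eval₀ (pderiv j g) • coord j ∈ maximalIdeal (SymplecticGerms n) ^ 2 := by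
  classical
  obtain ⟨h, hgh⟩ := exists_eq_add_sum_mul_coord g
  rw [hg, map_zero, zero_add] at hgh
  have hd : ∀ i, eval₀ (pderiv i g) = eval₀ (h i) := by
    intro i
    rw [hgh, map_sum, map_sum]
    simp [Derivation.leibniz, pderiv_coord, eval₀_coord, apply_ite eval₀]
  have h2 : g - ∑ j, eval₀ (pderiv j g) • coord j =
      ∑ j, (h j - algebraMap ℂ _ (eval₀ (h j))) * coord j := by
    simp only [hd]
    nth_rewrite 1 [hgh]
    rw [← Finset.sum_sub_distrib]
    refine Finset.sum_congr rfl fun j _ => ?_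
    rw [sub_mul, Algebra.smul_def]
  rw [h2, pow_two]
  refine Ideal.sum_mem _ fun j _ => Ideal.mul_mem_mul ?_
    (ConvergentSeries.mem_maximalIdeal.2 (eval₀_coord j))
  rw [ConvergentSeries.mem_maximalIdeal, map_sub, AlgHom.commutes]
  simp

variable [IsLocalRing (SymplecticGerms n ⧸ I)]

theorem mk_mem_maximalIdeal_iff {g : SymplecticGerms n} :
    Ideal.Quotient.mk I g ∈ maximalIdeal (SymplecticGerms n ⧸ I) ↔ eval₀ g = 0 := by
  have hloc := IsLocalHom.of_surjective (Ideal.Quotient.mk I) Ideal.Quotient.mk_surjective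
  rw [← ConvergentSeries.mem_maximalIdeal]
  exact map_mem_nonunits_iff (Ideal.Quotient.mk I) g

theorem mk_sub_linearFormGerm_mem {g : SymplecticGerms n} (hg : eval₀ g = 0) :
    Ideal.Quotient.mk I g - linearFormGerm I (fun j => eval₀ (pderiv j g)) ∈
      maximalIdeal (SymplecticGerms n ⧸ I) ^ 2 := by
  have h := Ideal.mem_map_of_mem (Ideal.Quotient.mk I) (sub_linear_mem_maximalIdeal_sq hg)
  rw [Ideal.map_pow, map_sub, map_sum] at h
  rw [linearFormGerm_apply]
  refine Ideal.pow_right_mono (Ideal.map_le_iff_le_comap.2 fun y hy => ?_) 2 h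
  exact mk_mem_maximalIdeal_iff.2 (ConvergentSeries.mem_maximalIdeal.1 hy)

theorem exists_sub_linearFormGerm_mem {y : SymplecticGerms n ⧸ I}
    (hy : y ∈ maximalIdeal (SymplecticGerms n ⧸ I)) :
    ∃ c, y - linearFormGerm I c ∈ maximalIdeal (SymplecticGerms n ⧸ I) ^ 2 := by
  obtain ⟨g, rfl⟩ := Ideal.Quotient.mk_surjective y
  exact ⟨_, mk_sub_linearFormGerm_mem (mk_mem_maximalIdeal_iff.1 hy)⟩

theorem linearFormGerm_mem (c : Fin n ⊕ Fin n → ℂ) :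
    linearFormGerm I c ∈ maximalIdeal (SymplecticGerms n ⧸ I) := by
  rw [linearFormGerm_apply]
  refine Ideal.sum_mem _ fun j _ => Submodule.smul_of_tower_mem _ _ ?_
  exact mk_mem_maximalIdeal_iff.2 (eval₀_coord j)

/-- A germ of dimension `n` with `n` independent linear forms of order two is smooth. -/
theorem isRegularLocalRing_of_le_finrank
    (hdim : (n : WithBot ℕ∞) ≤ ringKrullDim (SymplecticGerms n ⧸ I))
    (W : Submodule ℂ (Fin n ⊕ Fin n → ℂ))
    (hW : ∀ c ∈ W, linearFormGerm I c ∈ maximalIdeal (SymplecticGerms n ⧸ I) ^ 2)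
    (h : n ≤ Module.finrank ℂ W) : IsRegularLocalRing (SymplecticGerms n ⧸ I) := by
  obtain ⟨U, hU⟩ := W.exists_isCompl
  have hfin := Submodule.finrank_add_eq_of_isCompl hU
  rw [Module.finrank_fintype_fun_eq_card, Fintype.card_sum, Fintype.card_fin] at hfin
  let b := Module.finBasis ℂ U
  let N : Ideal (SymplecticGerms n ⧸ I) :=
    Ideal.span (Set.range fun i => linearFormGerm I (b i : Fin n ⊕ Fin n → ℂ))
  have hUN : ∀ u ∈ U, linearFormGerm I u ∈ N := by
    intro u hu
    have h1 := congrArg Subtype.val (b.sum_repr ⟨u, hu⟩)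
    simp only [AddSubmonoidClass.coe_finsetSum, Submodule.coe_smul] at h1
    rw [← h1, map_sum]
    refine Ideal.sum_mem _ fun i _ => ?_
    rw [map_smul]
    exact Submodule.smul_of_tower_mem _ _ (Ideal.subset_span ⟨i, rfl⟩)
  -- Forms in W vanish modulo m², so by Nakayama the at most n basis forms of the complement U
  -- generate m. The embedding dimension then does not exceed the dimension.
  have hle : maximalIdeal (SymplecticGerms n ⧸ I) ≤
      N ⊔ maximalIdeal (SymplecticGerms n ⧸ I) • maximalIdeal (SymplecticGerms n ⧸ I) := by
    conv_lhs => rw [maximalIdeal_quotient_eq_span]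
    rw [Ideal.span_le]
    rintro _ ⟨j, rfl⟩
    obtain ⟨w, hw, u, hu, hwu⟩ := Submodule.mem_sup.1
      (hU.sup_eq_top ▸ Submodule.mem_top : (Pi.single j 1 : Fin n ⊕ Fin n → ℂ) ∈ W ⊔ U)
    have h1 := linearFormGerm_single (I := I) j
    rw [← hwu, map_add] at h1
    change Ideal.Quotient.mk I (coord j) ∈ _
    rw [← h1]
    refine Ideal.add_mem _ (Ideal.mem_sup_right ?_) (Ideal.mem_sup_left (hUN u hu))
    have h2 := hW w hw
    rwa [pow_two] at h2
  have hN : maximalIdeal (SymplecticGerms n ⧸ I) = N := by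
    apply le_antisymm
    · exact Submodule.le_of_le_smul_of_le_jacobson_bot (IsNoetherian.noetherian _)
        (maximalIdeal_le_jacobson _) hle
    · rw [Ideal.span_le]
      rintro _ ⟨i, rfl⟩
      exact linearFormGerm_mem _
  refine IsRegularLocalRing.of_spanFinrank_maximalIdeal_le _ (le_trans ?_ hdim)
  rw [hN]
  have h1 : N.spanFinrank ≤ n := by
    refine (Submodule.spanFinrank_span_le_ncard_of_finite (Set.finite_range _)).trans ?_
    rw [← Set.image_univ]
    refine (Set.ncard_image_le Set.finite_univ).trans ?_
    rw [Set.ncard_univ, Nat.card_eq_fintype_card, Fintype.card_fin]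
    omega
  exact_mod_cast h1

end Regular

/-! ### The two smoothness criteria -/

section Smoothness

open ConvergentSeries Matrix IsLocalRing

theorem map_J_mulVec {n : ℕ} {R S F : Type*} [CommRing R] [CommRing S] [FunLike F R S]
    [AddMonoidHomClass F R S] (φ : F) (w : Fin n ⊕ Fin n → R) (j : Fin n ⊕ Fin n) :
    φ ((Matrix.J (Fin n) R *ᵥ w) j) = (Matrix.J (Fin n) S *ᵥ fun l => φ (w l)) j := by
  rcases j with i | i
  · rw [J_mulVec_inl, J_mulVec_inl, map_neg]
  · rw [J_mulVec_inr, J_mulVec_inr]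

theorem ConvergentSeries.pderiv_comm {σ : Type*} (i j : σ) (f : ConvergentSeries σ) :
    pderiv i (pderiv j f) = pderiv j (pderiv i f) := by
  by_cases h : i = j
  · rw [h]
  refine ext_coeff fun d => ?_
  rw [coeff_pderiv, coeff_pderiv, coeff_pderiv, coeff_pderiv, add_right_comm]
  simp [Finsupp.single_eq_of_ne h, Finsupp.single_eq_of_ne (Ne.symm h)]
  ring

theorem Derivation.apply_mem_of_apply_mem {R A : Type*} [CommRing R] [CommRing A] [Algebra R A]
    (E : Derivation R A A) {s : Set A} (hs : ∀ x ∈ s, E x ∈ Ideal.span s) {y : A}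
    (hy : y ∈ Ideal.span s) : E y ∈ Ideal.span s := by
  induction hy using Submodule.span_induction with
  | mem x hx => exact hs x hx
  | zero => rw [map_zero]; exact Submodule.zero_mem _
  | add x y _ _ hx hy => rw [map_add]; exact Submodule.add_mem _ hx hy
  | smul a x hx ih =>
    rw [smul_eq_mul, Derivation.leibniz]
    exact Submodule.add_mem _ (Submodule.smul_mem _ _ ih) (Ideal.mul_mem_right _ _ hx)

theorem Derivation.apply_mem_sq {R A : Type*} [CommRing R] [CommRing A] [Algebra R A]
    (E : Derivation R A A) {M : Ideal A} (hM : ∀ y ∈ M, E y ∈ M) {y : A} (hy : y ∈ M ^ 2) :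
    E y ∈ M ^ 2 := by
  rw [pow_two] at hy ⊢
  refine Submodule.mul_induction_on hy (fun a ha b hb => ?_) fun a b ha hb => ?_
  · rw [Derivation.leibniz, smul_eq_mul, smul_eq_mul]
    exact Ideal.add_mem _ (Ideal.mul_mem_mul ha (hM b hb)) (Ideal.mul_mem_mul hb (hM a ha))
  · rw [map_add]
    exact Ideal.add_mem _ ha hb

variable {n : ℕ} {I : Ideal (SymplecticGerms n)} [IsLocalRing (SymplecticGerms n ⧸ I)]

/-- Evaluated at the origin, D still has rank n, so the linear parts of the f_i are n independent
forms. Each lies in m² because f_i vanishes on the germ. -/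
theorem isRegularLocalRing_of_jacobianMatrix_surjective
    (hdim : (n : WithBot ℕ∞) ≤ ringKrullDim (SymplecticGerms n ⧸ I))
    {f : Fin n → SymplecticGerms n} (hf : ∀ i, f i ∈ I)
    (hsurj : ∀ u, ∃ d, jacobianMatrix I f *ᵥ d = u) :
    IsRegularLocalRing (SymplecticGerms n ⧸ I) := by
  classical
  have hI : ∀ g ∈ I, eval₀ g = 0 := fun g hg => by
    rw [← mk_mem_maximalIdeal_iff (I := I), Ideal.Quotient.eq_zero_iff_mem.2 hg]
    exact Ideal.zero_mem _
  let D : Matrix (Fin n) (Fin n ⊕ Fin n) ℂ := Matrix.of fun i j => eval₀ (pderiv j (f i))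
  have hD : ∀ a, Dᵀ *ᵥ a = 0 → a = 0 := by
    intro a ha
    funext i
    obtain ⟨d, hd⟩ := hsurj (Pi.single i 1)
    choose v hv using fun j => Ideal.Quotient.mk_surjective (d j)
    have h1 : D *ᵥ (fun j => eval₀ (v j)) = Pi.single i 1 := by
      funext k
      have h2 : ∑ j, pderiv j (f k) * v j - (Pi.single i 1 : Fin n → SymplecticGerms n) k ∈ I := by
        rw [← Ideal.Quotient.eq_zero_iff_mem, map_sub, sub_eq_zero]
        have h3 := congrFun hd k
        have h4 : Ideal.Quotient.mk I ((Pi.single i 1 : Fin n → SymplecticGerms n) k) =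
            (Pi.single i 1 : Fin n → SymplecticGerms n ⧸ I) k := by
          simp only [Pi.single_apply, apply_ite (Ideal.Quotient.mk I), map_one, map_zero]
        rw [h4, ← h3, map_sum, Matrix.mulVec, dotProduct]
        refine Finset.sum_congr rfl fun j _ => ?_
        rw [map_mul, hv]
        rfl
      have h3 := hI _ h2
      rw [map_sub, sub_eq_zero, map_sum] at h3
      simp only [map_mul, Pi.single_apply, apply_ite eval₀, map_one, map_zero] at h3
      rw [Pi.single_apply]
      exact h3
    have h2 : a ⬝ᵥ (D *ᵥ fun j => eval₀ (v j)) = 0 := by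
      rw [Matrix.dotProduct_mulVec, ← Matrix.mulVec_transpose, ha, zero_dotProduct]
    rwa [h1, dotProduct_single_one] at h2
  refine isRegularLocalRing_of_le_finrank hdim (LinearMap.range Dᵀ.mulVecLin) ?_ ?_
  · rintro _ ⟨a, rfl⟩
    have h1 : Dᵀ *ᵥ a = ∑ i, a i • fun j => eval₀ (pderiv j (f i)) := by
      funext j
      rw [Matrix.mulVec, dotProduct, Finset.sum_apply]
      exact Finset.sum_congr rfl fun i _ => mul_comm _ _
    rw [Matrix.mulVecLin_apply, h1, map_sum]
    refine Ideal.sum_mem _ fun i _ => ?_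
    rw [map_smul]
    refine Submodule.smul_of_tower_mem _ _ ?_
    have h2 := mk_sub_linearFormGerm_mem (I := I) (hI _ (hf i))
    rwa [Ideal.Quotient.eq_zero_iff_mem.2 (hf i), zero_sub, neg_mem_iff] at h2
  · rw [LinearMap.finrank_range_of_inj ((injective_iff_map_eq_zero Dᵀ.mulVecLin).2 hD),
      Module.finrank_fintype_fun_eq_card, Fintype.card_fin]

/-- Write E = {F, ·}. On linear forms modulo m² it acts by the transpose of J Hess F(0), a
hamiltonian matrix. The forms lying in m² make up an invariant subspace W, and the linear parts of
the x_i are eigenvectors with positive eigenvalues spanning the quotient, so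
`le_finrank_of_hamiltonian` bounds dim W from below by n. -/
theorem isRegularLocalRing_of_isQuasiHomogeneousAlgebra
    (hdim : (n : WithBot ℕ∞) ≤ ringKrullDim (SymplecticGerms n ⧸ I))
    (hham : ∀ D : TangentModule I, ∃ F : SymplecticGerms n, ∀ g,
      D (Ideal.Quotient.mk I g) = Ideal.Quotient.mk I (poissonBracket F g))
    (hq : IsQuasiHomogeneousAlgebra (SymplecticGerms n ⧸ I)) :
    IsRegularLocalRing (SymplecticGerms n ⧸ I) := by
  classical
  obtain ⟨E, k, x, w, hmax, hx⟩ := hq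
  have hspan := IsLocalRing.eq_maximalIdeal hmax
  set m := maximalIdeal (SymplecticGerms n ⧸ I) with hm
  have hxm : ∀ i, x i ∈ m := fun i => hspan ▸ Ideal.subset_span ⟨i, rfl⟩
  have hEm : ∀ y ∈ m, E y ∈ m := by
    rw [← hspan]
    refine fun y hy => E.apply_mem_of_apply_mem ?_ hy
    rintro _ ⟨i, rfl⟩
    rw [(hx i).2]
    exact Submodule.smul_of_tower_mem _ _ (Ideal.subset_span ⟨i, rfl⟩)
  obtain ⟨F, hF⟩ := hham E
  have hG : ∀ j, E (Ideal.Quotient.mk I (coord j)) = Ideal.Quotient.mk I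
      ((Matrix.J (Fin n) (SymplecticGerms n) *ᵥ fun l => pderiv l F) j) := by
    intro j
    rw [hF, mk_poissonBracket, map_J_mulVec (Ideal.Quotient.mk I)]
    simp only [pderiv_coord, apply_ite (Ideal.Quotient.mk I), map_one, map_zero, ite_mul, one_mul,
      zero_mul, Finset.sum_ite_eq', Finset.mem_univ, if_true]
  let H : Matrix (Fin n ⊕ Fin n) (Fin n ⊕ Fin n) ℂ :=
    Matrix.of fun l k => eval₀ (pderiv k (pderiv l F))
  have hH : Hᵀ = H := by
    ext l k
    exact congrArg eval₀ (pderiv_comm _ _ F)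
  have hGH : ∀ j, E (Ideal.Quotient.mk I (coord j)) -
      linearFormGerm I (fun k => (Matrix.J (Fin n) ℂ * H) j k) ∈ m ^ 2 := by
    intro j
    -- E preserves m, so the components of J ∇F vanish at the origin and their expansions start with
    -- the linear terms J Hess F(0).
    have h0 := hEm _ (mk_mem_maximalIdeal_iff.2 (eval₀_coord j))
    rw [hG] at h0 ⊢
    convert! mk_sub_linearFormGerm_mem (mk_mem_maximalIdeal_iff.1 h0) using 4
    rw [map_J_mulVec (pderiv _), map_J_mulVec eval₀]
    rfl
  have hE : ∀ c, E (linearFormGerm I c) - linearFormGerm I ((Matrix.J (Fin n) ℂ * H)ᵀ *ᵥ c) ∈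
      m ^ 2 := by
    intro c
    have h1 : (Matrix.J (Fin n) ℂ * H)ᵀ *ᵥ c =
        ∑ j, c j • fun k => (Matrix.J (Fin n) ℂ * H) j k := by
      funext k
      rw [Matrix.mulVec, dotProduct, Finset.sum_apply]
      exact Finset.sum_congr rfl fun i _ => mul_comm _ _
    rw [h1, linearFormGerm_apply, map_sum, map_sum, ← Finset.sum_sub_distrib]
    refine Ideal.sum_mem _ fun j _ => ?_
    rw [Derivation.map_smul, LinearMap.map_smul, ← smul_sub]
    exact Submodule.smul_of_tower_mem _ _ (hGH j)
  let W : Submodule ℂ (Fin n ⊕ Fin n → ℂ) :=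
    ((m ^ 2).restrictScalars ℂ).comap (linearFormGerm I)
  have hWmem : ∀ c, c ∈ W ↔ linearFormGerm I c ∈ m ^ 2 := fun _ => Iff.rfl
  choose c hc using fun i => exists_sub_linearFormGerm_mem (hxm i)
  refine isRegularLocalRing_of_le_finrank hdim W (fun c hc => hc)
    (le_finrank_of_hamiltonian hH ?_ c w (fun i => (hx i).1) ?_ ?_)
  · intro c hc
    have h1 := Ideal.sub_mem _ (E.apply_mem_sq hEm ((hWmem c).1 hc)) (hE c)
    rwa [sub_sub_cancel] at h1
  · intro i
    rw [hWmem, map_sub, map_smul]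
    have h1 := E.apply_mem_sq hEm (hc i)
    rw [map_sub, (hx i).2] at h1
    have h2 := Submodule.smul_of_tower_mem _ (w i : ℂ) (hc i)
    rw [smul_sub, Nat.cast_smul_eq_nsmul] at h2
    have h3 := Ideal.sub_mem _ (Ideal.sub_mem _ h2 h1) (hE (c i))
    convert! h3 using 1
    rw [Nat.cast_smul_eq_nsmul]
    abel
  · rw [eq_top_iff]
    intro d _
    have h1 := linearFormGerm_mem (I := I) d
    rw [← hm, ← hspan, Ideal.mem_span_range_iff_exists_fun] at h1
    obtain ⟨r, hr⟩ := h1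
    choose s hs using fun i => Ideal.Quotient.mk_surjective (r i)
    -- Modulo m² the coefficients of the x_i may be replaced by their values at the origin.
    have h2 : d - ∑ i, eval₀ (s i) • c i ∈ W := by
      rw [hWmem, map_sub, map_sum, ← hr, ← Finset.sum_sub_distrib]
      refine Ideal.sum_mem _ fun i _ => ?_
      have h3 : r i - algebraMap ℂ _ (eval₀ (s i)) ∈ m := by
        have : r i - algebraMap ℂ _ (eval₀ (s i)) =
            Ideal.Quotient.mk I (s i - algebraMap ℂ _ (eval₀ (s i))) := by
          rw [map_sub, hs]
          rfl
        rw [this, mk_mem_maximalIdeal_iff, map_sub, AlgHom.commutes]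
        simp
      have h4 : r i * x i - linearFormGerm I (eval₀ (s i) • c i) =
          (r i - algebraMap ℂ _ (eval₀ (s i))) * x i +
            eval₀ (s i) • (x i - linearFormGerm I (c i)) := by
        rw [map_smul, smul_sub, sub_mul, ← Algebra.smul_def]
        abel
      rw [h4]
      refine Ideal.add_mem _ ?_ (Submodule.smul_of_tower_mem _ _ (hc i))
      rw [pow_two]
      exact Ideal.mul_mem_mul h3 (hxm i)
    rw [← sub_add_cancel d (∑ i, eval₀ (s i) • c i)]
    exact Submodule.add_mem _ (Submodule.mem_sup_left h2) (Submodule.mem_sup_right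
      (Submodule.sum_mem _ fun i _ => Submodule.smul_mem _ _ (Submodule.subset_span ⟨i, rfl⟩)))

end Smoothness

/-! ## Lagrangian complete intersections -/

section Lagrangian

open ConvergentSeries Matrix IsLocalRing

variable {n : ℕ} {I : Ideal (SymplecticGerms n)}

theorem IsLagrangianGerm.ringKrullDim_eq (hL : IsLagrangianGerm I) :
    ringKrullDim (SymplecticGerms n ⧸ I) = n := by
  apply le_antisymm
  · rw [ringKrullDim_quotient, Order.krullDim_eq_iSup_coheight]
    refine iSup_le fun Q => ?_
    obtain ⟨P, hP, hPQ⟩ := Ideal.exists_minimalPrimes_le Q.2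
    have h := coheight_le_of_ringKrullDim_quotient_le (hL.dim_eq P hP).le Q.1 hPQ
    exact_mod_cast (Order.coheight_le_coheight_apply_of_strictMono Subtype.val
      (Subtype.strictMono_coe _) Q).trans h
  · obtain ⟨P, hP⟩ := I.nonempty_minimalPrimes hL.ne_top
    rw [← hL.dim_eq P hP]
    exact ringKrullDim_le_of_surjective (Ideal.Quotient.factor hP.1.2)
      (Ideal.Quotient.factor_surjective hP.1.2)

theorem IsLagrangianGerm.exists_generators (hL : IsLagrangianGerm I)
    (hci : IsCompleteIntersectionGerm I) :
    ∃ f : Fin n → SymplecticGerms n, Ideal.span (Set.range f) = I := by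
  obtain ⟨k, f, hf, hk⟩ := hci
  rw [hL.ringKrullDim_eq] at hk
  have hk' : n + k = 2 * n := by exact_mod_cast hk
  obtain rfl : k = n := by omega
  exact ⟨f, hf⟩

/-- The ambient ring has depth 2n and the n generators cut the dimension down to n, so they form a
regular sequence and leave depth n. -/
theorem IsLagrangianGerm.hasDepth_bot (hL : IsLagrangianGerm I)
    [IsLocalRing (SymplecticGerms n ⧸ I)] {f : Fin n → SymplecticGerms n}
    (hf : Ideal.span (Set.range f) = I) :
    HasDepth n (⊥ : Ideal (SymplecticGerms n ⧸ I)) := by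
  have hcard : Fintype.card (Fin n ⊕ Fin n) = 2 * n := by
    rw [Fintype.card_sum, Fintype.card_fin, two_mul]
  have hn : 2 * n - n = n := by omega
  have h := HasDepth.span_range (hcard ▸ ConvergentSeries.hasDepth_bot (σ := Fin n ⊕ Fin n))
    (by omega : n ≤ 2 * n) f
    (fun i => le_maximalIdeal hL.ne_top (hf ▸ Ideal.subset_span ⟨i, rfl⟩))
    (by rw [hf, hL.ringKrullDim_eq, hn])
  rw [hf, hn] at h
  refine HasDepth.quotient ?_
  rwa [← RingHom.ker_eq_comap_bot, Ideal.mk_ker]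

theorem not_maximalMinors_le_of_mem_minimalPrimes {f : Fin n → SymplecticGerms n}
    (hheight : 2 ≤ (maximalMinors (jacobianMatrix I f)).height)
    (P : Ideal (SymplecticGerms n ⧸ I)) (hP : P ∈ minimalPrimes (SymplecticGerms n ⧸ I)) :
    ¬ maximalMinors (jacobianMatrix I f) ≤ P := by
  intro hle
  have := hP.1.1
  have h := hheight.trans (Ideal.height_mono hle)
  rw [Ideal.height_eq_zero_iff.2 hP] at h
  exact absurd h (by norm_num)

end Lagrangian

theorem mainTheorem5 (n : ℕ) (I : Ideal (SymplecticGerms n))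
    (hL : IsLagrangianGerm I) (hci : IsCompleteIntersectionGerm I)
    (hsing : 2 ≤ codimSing I) :
    Module.Free (SymplecticGerms n ⧸ I) (TangentModule I) ∧
    (∃ e : I.Cotangent ≃ₗ[SymplecticGerms n ⧸ I] TangentModule I,
      ∀ (f : I) (g : SymplecticGerms n),
        e (I.toCotangent f) (Ideal.Quotient.mk I g) =
          Ideal.Quotient.mk I (poissonBracket f.1 g)) ∧
    (IsQuasiHomogeneousAlgebra (SymplecticGerms n ⧸ I) →
      IsRegularLocalRing (SymplecticGerms n ⧸ I)) ∧
    (3 ≤ codimSing I → IsRegularLocalRing (SymplecticGerms n ⧸ I)) := by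
  have := ConvergentSeries.isLocalRing_quotient hL.ne_top
  have := Ideal.isRadical_iff_quotient_reduced I |>.1 hL.isRadical
  obtain ⟨f, hf⟩ := hL.exists_generators hci
  have hfI : ∀ i, f i ∈ I := fun i => hf ▸ Ideal.subset_span ⟨i, rfl⟩
  have hdim := hL.ringKrullDim_eq
  have hle := Ideal.height_mono (singularLocusIdeal_le_maximalMinors hf)
  have hheight : 2 ≤ (maximalMinors (jacobianMatrix I f)).height := hsing.trans hle
  have hiso := dotProduct_J_mulVec_eq_zero hf hL.isotropic
  have hzero := mul_J_mul_transpose_eq_zero (jacobianMatrix I f)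
    (not_maximalMinors_le_of_mem_minimalPrimes hheight) hiso
  rw [Matrix.mul_assoc] at hzero
  obtain ⟨t₁, h₁, t₂, h₂, hr₁, hr₂, h3⟩ :=
    exists_regular_pair (hL.hasDepth_bot hf) hdim.le hheight
  have hker := fun v => mem_range_of_mulVec_eq_zero (v := v) h₁ h₂ hr₁ hr₂ hiso
  obtain ⟨μ, hμ⟩ := exists_linearEquiv_tangentModule hf hzero
    (fun _ => eq_zero_of_J_mul_transpose_mulVec_eq_zero h₁ hr₁) hker
  obtain ⟨e, he⟩ := exists_cotangent_linearEquiv_tangentModule hf μ hμ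
    (fun _ => eq_zero_of_transpose_mulVec_eq_zero h₁ hr₁)
  refine ⟨.of_equiv μ, ⟨e, he⟩, ?_, fun h => ?_⟩
  -- Surjectivity of the isomorphism from I/I² makes every vector field on L hamiltonian, in
  -- particular the Euler field.
  · refine isRegularLocalRing_of_isQuasiHomogeneousAlgebra hdim.ge fun D => ?_
    obtain ⟨y, rfl⟩ := e.surjective D
    obtain ⟨F, rfl⟩ := I.toCotangent_surjective y
    exact ⟨F.1, he F⟩
  · obtain ⟨t₃, h₃, hr₃⟩ := h3 (h.trans hle)
    exact isRegularLocalRing_of_jacobianMatrix_surjective hdim.ge hfI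
      (mulVec_surjective h₁ h₂ h₃ hr₁ hr₂ hr₃ hker hzero)
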